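/- Let $p,q\in\mathbb{C}$ be nonzero with $p\neq q$ and $q$ not a root of unity, and write $[n]=[n]_{p,q}=\dfrac{p^n-q^n}{p-q}$ for $n\in\mathbb{Z}$. A module over the two-parameter deformed Virasoro algebra $V_{p,q}$ is a complex vector space $V$ with linear operators $L_n$ $(n\in\mathbb{Z})$ satisfying $$(p^{-n}q^{n}L_nL_m-p^{-m}q^{m}L_mL_n)v=\Big(\frac{[m]}{p^{m}}-\frac{[n]}{p^{n}}\Big)L_{m+n}v\qquad(m,n\in\mathbb{Z},\ v\in V).$$ Its weight spaces are $V_\lambda=\{v\in V: L_0v=\lambda v\}$, $\lambda\in\mathbb{C}$; it is a Harish-Chandra module if $V=\bigoplus_{\lambda\in\mathbb{C}}V_\lambda$. A submodule is a subspace stable under all $L_n$; $V$ is indecomposable if it is nonzero and is not the direct sum of two nonzero submodules; an isomorphism is a linear bijection commuting with all $L_n$. For $a,b,\alpha,\alpha',\beta,\beta'\in\mathbb{C}$ define operators $L_n$ $(n\in\mathbb{Z})$ on the space with basis $(v_j)_{j\in\mathbb{Z}}$ by \begin{align*} V_{p,q}(a,b):\quad & L_nv_j=\big(p^{-j}[j]-ap^{-j}q^{j}-bp^{-j-n}q^{j}[n]\big)v_{n+j};\\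 V_{p,q}(\alpha):\quad & L_nv_j=p^{-n-j-1}[n+j+1]\,v_{n+j}\ (j\neq-1),\\ & L_nv_{-1}=\big(-q^{n}[-n]+p^{-n}q^{n}[-n][n+1]\alpha\big)v_{n-1};\\ V'_{p,q}(\alpha'):\quad & L_nv_j=p^{-j}[j]\,v_{n+j}\ (j\neq-n),\\ & L_nv_{-n}=\big(p^{n}[-n]+p^{n}q^{-n}[-n][n+1]\alpha'\big)v_0;\\ V_{p,q}(\beta):\quad & L_nv_j=-q^{n+j-1}[-n-j+1]\,v_{n+j}\ (j\neq1),\\ & L_nv_{1}=\big(-q^{n}[-n]+p^{-n}q^{n}[n][-n+1]\beta\big)v_{n+1};\\ V'_{p,q}(\beta'):\quad & L_nv_j=p^{-j}[j]\,v_{n+j}\ (j\neq-n),\\ & L_nv_{-n}=\big(p^{n}[-n]+p^{n}q^{-n}[n][-n+1]\beta'\big)v_0. \end{align*} All of these are $V_{p,q}$-modules. Let $V$ be an indecomposable Harish-Chandra $V_{p,q}$-module all of whose nonzero weight spaces are one-dimensional, and suppose that $V$ has the shape of a module of the intermediate series, that is, $V=\bigoplus_{k\in\mathbb{Z}}\mathbb{C}v_k$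 for some basis $(v_k)_{k\in\mathbb{Z}}$ with $L_nv_k\in\mathbb{C}v_{n+k}$ for all $n,k\in\mathbb{Z}$. Then $V$ is isomorphic to $V_{p,q}(a,b)$, $V_{p,q}(\alpha)$, $V'_{p,q}(\alpha')$, $V_{p,q}(\beta)$ or $V'_{p,q}(\beta')$ for some values of the complex parameters. -/

import Mathlib

namespace Vpq

/-- The two-parameter quantum integer `[n]_{p,q} = (p^n - q^n) / (p - q)`. -/
noncomputable def qint (p q : ℂ) (n : ℤ) : ℂ := (p ^ n - q ^ n) / (p - q)

/-- The operators `L n` (the action of the generators `L_n`) make the complex vector space `M` a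
module over the two-parameter deformed Virasoro algebra `V_{p,q}`. The central element does not
occur in the defining relation of a module. -/
def IsModule (p q : ℂ) {M : Type*} [AddCommGroup M] [Module ℂ M]
    (L : ℤ → Module.End ℂ M) : Prop :=
  ∀ (n m : ℤ) (v : M),
    (p ^ (-n) * q ^ n) • L n (L m v) - (p ^ (-m) * q ^ m) • L m (L n v)
      = (qint p q m / p ^ m - qint p q n / p ^ n) • L (m + n) v

section
variable {M : Type*} [AddCommGroup M] [Module ℂ M]

/-- The weight space `M_lam = {v | L_0 v = lam v}`. -/
abbrev weightSpace (L : ℤ → Module.End ℂ M) (lam : ℂ) : Submodule ℂ M :=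
  (L 0).eigenspace lam

/-- Harish-Chandra: `M` is the direct sum of its weight spaces. -/
def IsHarishChandra (L : ℤ → Module.End ℂ M) : Prop :=
  DirectSum.IsInternal (weightSpace L)

/-- Every (nonzero) weight space is one-dimensional. -/
def HasOneDimWeightSpaces (L : ℤ → Module.End ℂ M) : Prop :=
  ∀ lam : ℂ, weightSpace L lam ≠ ⊥ → Module.finrank ℂ (weightSpace L lam) = 1

/-- Shape of a module of the intermediate series: `M = ⨁_{k ∈ ℤ} ℂ v_k` with
`L_n v_k ∈ ℂ v_{n+k}` for all integers `n`, `k`. -/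
def IsZGraded (L : ℤ → Module.End ℂ M) : Prop :=
  ∃ v : Module.Basis ℤ ℂ M, ∀ n k : ℤ, L n (v k) ∈ Submodule.span ℂ {v (n + k)}

/-- A subspace is a `V_{p,q}`-submodule if it is stable under every `L_n`. -/
def IsSubmodule (L : ℤ → Module.End ℂ M) (U : Submodule ℂ M) : Prop :=
  ∀ (n : ℤ), ∀ v ∈ U, L n v ∈ U

/-- Indecomposable: nonzero, and not the direct sum of two nonzero submodules. -/
def IsIndecomposable (L : ℤ → Module.End ℂ M) : Prop :=
  Nontrivial M ∧ ∀ U W : Submodule ℂ M, IsSubmodule L U → IsSubmodule L W → IsCompl U W →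
    U = ⊥ ∨ W = ⊥

/-- Isomorphism of `V_{p,q}`-modules: a linear bijection commuting with every `L_n`. -/
def Iso {N : Type*} [AddCommGroup N] [Module ℂ N]
    (L : ℤ → Module.End ℂ M) (L' : ℤ → Module.End ℂ N) : Prop :=
  ∃ e : M ≃ₗ[ℂ] N, ∀ (n : ℤ) (x : M), e (L n x) = L' n (e x)

end

/-- The operators `L_n v_j = c n j • v_{n+j}` on the space with basis `v_j = Finsupp.single j 1`,
`j ∈ ℤ`. -/
noncomputable def action (c : ℤ → ℤ → ℂ) (n : ℤ) : Module.End ℂ (ℤ →₀ ℂ) :=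
  Finsupp.linearCombination ℂ (fun j : ℤ => Finsupp.single (n + j) (c n j))

/-- `V_{p,q}(a,b)`. -/
noncomputable def actAB (p q a b : ℂ) : ℤ → Module.End ℂ (ℤ →₀ ℂ) :=
  action fun n j =>
    p ^ (-j) * qint p q j - a * p ^ (-j) * q ^ j - b * p ^ (-j - n) * q ^ j * qint p q n

/-- `V_{p,q}(α)`. -/
noncomputable def actAlpha (p q α : ℂ) : ℤ → Module.End ℂ (ℤ →₀ ℂ) :=
  action fun n j =>
    if j = -1 then
      -q ^ n * qint p q (-n) + qint p q (-n) * qint p q (n + 1) * p ^ (-n) * q ^ n * α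
    else p ^ (-n - j - 1) * qint p q (n + j + 1)

/-- `V'_{p,q}(α')`. -/
noncomputable def actAlpha' (p q α' : ℂ) : ℤ → Module.End ℂ (ℤ →₀ ℂ) :=
  action fun n j =>
    if j = -n then
      p ^ n * qint p q (-n) + p ^ n * q ^ (-n) * qint p q (-n) * qint p q (n + 1) * α'
    else p ^ (-j) * qint p q j

/-- `V_{p,q}(β)`. -/
noncomputable def actBeta (p q β : ℂ) : ℤ → Module.End ℂ (ℤ →₀ ℂ) :=
  action fun n j =>
    if j = 1 then
      -q ^ n * qint p q (-n) + p ^ (-n) * q ^ n * qint p q n * qint p q (-n + 1) * β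
    else -q ^ (n + j - 1) * qint p q (-n - j + 1)

/-- `V'_{p,q}(β')`. -/
noncomputable def actBeta' (p q β' : ℂ) : ℤ → Module.End ℂ (ℤ →₀ ℂ) :=
  action fun n j =>
    if j = -n then
      p ^ n * qint p q (-n) + p ^ n * q ^ (-n) * qint p q n * qint p q (-n + 1) * β'
    else p ^ (-j) * qint p q j

end Vpq

/-! Put r = q/p. On a graded basis the module axiom becomes the scalar identity `IsCoeff` for the
numbers c n k, the coefficients of L_n v_k times p - q. Its case m = 0 says that c 0 (n+k) - 1 = r^n
(c 0 k - 1) whenever c n k ≠ 0. Indecomposability links all indices through nonzero coefficients, so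
c 0 k = 1 - ν r^k; as the weights are distinct, ν ≠ 0 and r is not a root of unity.

It remains to classify c up to rescaling the basis. Products of coefficients along closed paths do
not change under rescaling and obey first-order recursions in the starting index, so they are known
up to one constant. The loops of L_1 fix (A, b) up to the swap (A, b) ↔ (-b, -A), and the triangles
through L_2 and L_{-2} decide between the two (`exists_loops_eq`). Far up the L_1-loops do not
vanish, so a rescaling identifies the tail with that of a V_{p,q}(a,b) (`exists_regauge_tail`).

The tail controls every lower vector: for large n, n ↦ c n k solves a functional equation whose
solutions are x + y r^n with one linear constraint on (x, y) (`exists_affine`). The constraint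
leaves a line, hence one scalar to normalize, unless A r^k = 1 and b = 0, when V_{p,q}(a,b) would
annihilate v_k. Without such a k the module is V_{p,q}(a,b). With it, the arrows out of v_k and
those into v_k have two free parameters each; vanishing loops kill one pair, and the other is a
point of the projective line (`exists_source_or_target`). The α- and β-families each miss one point
of that line, and together they cover it (`exists_normalized`). -/

namespace Vpq

open Filter Polynomial

/-! ### Polynomials in `r ^ n` -/

section CoeffClassification

variable {r : ℂ}

theorem zpow_injective_of_not_root (h0 : r ≠ 0) (hr : ∀ n : ℤ, n ≠ 0 → r ^ n ≠ 1) :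
    Function.Injective fun n : ℤ => r ^ n := by
  intro a b hab
  by_contra hne
  refine hr (a - b) (sub_ne_zero.2 hne) ?_
  have hab' : r ^ a = r ^ b := hab
  rw [zpow_sub₀ h0, hab', div_self (zpow_ne_zero _ h0)]

theorem eventually_eval_zpow_ne_zero (h0 : r ≠ 0) (hr : ∀ n : ℤ, n ≠ 0 → r ^ n ≠ 1)
    {f : ℂ[X]} (hf : f ≠ 0) : ∀ᶠ n : ℤ in atTop, f.eval (r ^ n) ≠ 0 := by
  have hfin : {n : ℤ | f.eval (r ^ n) = 0}.Finite := by
    have := (f.roots.toFinset.finite_toSet).preimage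
      (f := fun n : ℤ => r ^ n) (zpow_injective_of_not_root h0 hr).injOn
    refine this.subset fun n hn => ?_
    simpa [hf] using hn
  have h := hfin.eventually_cofinite_notMem
  rw [Int.cofinite_eq] at h
  exact (Filter.eventually_sup.1 h).2

theorem eventually_add_mul_zpow_ne_zero (h0 : r ≠ 0) (hr : ∀ n : ℤ, n ≠ 0 → r ^ n ≠ 1)
    {x y : ℂ} (hxy : x = 0 → y ≠ 0) : ∀ᶠ n : ℤ in atTop, x + y * r ^ n ≠ 0 := by
  have hf : (C x + C y * X : ℂ[X]) ≠ 0 := by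
    intro h
    have h1 := congrArg (fun f => Polynomial.coeff f 0) h
    have h2 := congrArg (fun f => Polynomial.coeff f 1) h
    simp [coeff_C] at h1 h2
    exact hxy h1 h2
  simpa using eventually_eval_zpow_ne_zero h0 hr hf

/-- If the coefficient of `v` in a polynomial function of `v = r ^ n` is non-zero, the function has
only finitely many zeros. -/
theorem eventually_eval_zpow_ne_zero_of_derivative (h0 : r ≠ 0)
    (hr : ∀ n : ℤ, n ≠ 0 → r ^ n ≠ 1) {f : ℂ[X]} (hf : f.derivative.eval 0 ≠ 0) :
    ∀ᶠ n : ℤ in atTop, f.eval (r ^ n) ≠ 0 :=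
  eventually_eval_zpow_ne_zero h0 hr (by rintro rfl; simp at hf)

/-! ### The functional equation for the coefficients of one vector -/

section Affine

variable {A b : ℂ} {F : ℤ → ℂ} {N : ℤ}

/-- The operator rS² - (1+r)S + 1 = (rS - 1)(S - 1), with S the shift, kills exactly the functions y
+ x r^{-n}. Expressing F(2n+3) through the pairs (n, n+3) and (n+1, n+2) and eliminating it gives a
first-order recursion for this second difference. -/
theorem second_difference_step (h0 : r ≠ 0)
    (hF : ∀ n m, N ≤ n → N ≤ m → F m * (1 - A * r ^ m + b * r ^ n * r ^ m)
      - F n * (1 - A * r ^ n + b * r ^ n * r ^ m) = (r ^ n - r ^ m) * F (n + m))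
    {n : ℤ} (hn : N ≤ n) :
    (1 + b * r ^ n * r ^ n * r ^ 3 - A * r ^ n * r ^ 3)
        * (r * F (n + 3) - (1 + r) * F (n + 2) + F (n + 1))
      = r * (1 + b * r ^ n * r ^ n * r ^ 3 - A * r ^ n)
        * (r * F (n + 2) - (1 + r) * F (n + 1) + F n) := by
  have h1 := hF n (n + 3) hn (by linarith)
  have h2 := hF (n + 1) (n + 2) (by linarith) (by linarith)
  rw [show n + (n + 3) = 2 * n + 3 by ring] at h1
  rw [show n + 1 + (n + 2) = 2 * n + 3 by ring] at h2
  simp only [zpow_add₀ h0 n, zpow_ofNat] at h1 h2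
  linear_combination r * h1 - (1 + r + r ^ 2) * h2

/-- The values F(2n+1), F(2n+2), F(2n+3) all come from pairs among n, n+1, n+2, so the second
difference at 2n+1 is a multiple of the one at n. -/
theorem second_difference_double (h0 : r ≠ 0) (h1 : r ≠ 1)
    (hF : ∀ n m, N ≤ n → N ≤ m → F m * (1 - A * r ^ m + b * r ^ n * r ^ m)
      - F n * (1 - A * r ^ n + b * r ^ n * r ^ m) = (r ^ n - r ^ m) * F (n + m))
    {n : ℤ} (hn : N ≤ n) :
    r * F (2 * n + 3) - (1 + r) * F (2 * n + 2) + F (2 * n + 1)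
      = -b * r * r ^ n * (r * F (n + 2) - (1 + r) * F (n + 1) + F n) := by
  have h01 := hF n (n + 1) hn (by linarith)
  have h02 := hF n (n + 2) hn (by linarith)
  have h12 := hF (n + 1) (n + 2) (by linarith) (by linarith)
  rw [show n + (n + 1) = 2 * n + 1 by ring] at h01
  rw [show n + (n + 2) = 2 * n + 2 by ring] at h02
  rw [show n + 1 + (n + 2) = 2 * n + 3 by ring] at h12
  simp only [zpow_add₀ h0 n, zpow_ofNat] at h01 h02 h12
  have hv : r ^ n * (1 - r) ≠ 0 := mul_ne_zero (zpow_ne_zero _ h0) (sub_ne_zero.2 h1.symm)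
  refine mul_left_cancel₀ hv ?_
  linear_combination -h12 + h02 - h01

/-- Doubling and stepping are two ways from the second difference at n to the one at 2n+3. They
disagree by a nonzero polynomial in r^n, so the second difference vanishes for large n. -/
theorem second_difference_eventually_zero (h0 : r ≠ 0) (hr : ∀ n : ℤ, n ≠ 0 → r ^ n ≠ 1)
    (hA : A ≠ 0)
    (hF : ∀ n m, N ≤ n → N ≤ m → F m * (1 - A * r ^ m + b * r ^ n * r ^ m)
      - F n * (1 - A * r ^ n + b * r ^ n * r ^ m) = (r ^ n - r ^ m) * F (n + m)) :
    ∀ᶠ n : ℤ in atTop, r * F (n + 2) - (1 + r) * F (n + 1) + F n = 0 := by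
  have h1 : r ≠ 1 := by simpa using hr 1 one_ne_zero
  have h3 : r ^ 3 ≠ 1 := by
    have := hr 3 (by norm_num)
    rwa [zpow_ofNat] at this
  by_cases hb : b = 0
  · subst hb
    have key : ∀ n, N ≤ n → r * F (2 * n + 3) - (1 + r) * F (2 * n + 2) + F (2 * n + 1) = 0 := by
      intro n hn
      rw [second_difference_double h0 h1 hF hn]; ring
    -- For b = 0 doubling kills the second difference at odd indices. One step carries the zero to
    -- the next even index, once the factor 1 - A r^3 r^n is nonzero.
    have hne := eventually_add_mul_zpow_ne_zero h0 hr (x := 1) (y := -A * r ^ 3)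
      (fun h => absurd h one_ne_zero)
    obtain ⟨K, hK⟩ := eventually_atTop.1 hne
    refine eventually_atTop.2 ⟨2 * (|N| + |K|) + 3, fun n hn => ?_⟩
    have hN := le_abs_self N
    have hKa := le_abs_self K
    have hN' := abs_nonneg N
    have hKa' := abs_nonneg K
    obtain ⟨m, hm | hm⟩ : ∃ m, n = 2 * m + 1 ∨ n = 2 * m + 2 := ⟨(n - 1) / 2, by omega⟩
    · subst hm
      have := key m (by omega)
      rwa [show 2 * m + 1 + 2 = 2 * m + 3 by ring, show 2 * m + 1 + 1 = 2 * m + 2 by ring]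
    · subst hm
      have k1 := key m (by omega)
      have k2 := second_difference_step h0 hF (n := 2 * m + 1) (by omega)
      have k3 := hK (2 * m + 1) (by omega)
      rw [show 2 * m + 1 + 3 = 2 * m + 2 + 2 by ring, show 2 * m + 1 + 2 = 2 * m + 2 + 1 by ring,
        show 2 * m + 1 + 1 = 2 * m + 2 by ring] at k2
      rw [show 2 * m + 3 = 2 * m + 2 + 1 by ring] at k1
      rw [k1, mul_zero] at k2
      refine (mul_eq_zero.1 k2).resolve_left ?_
      intro h
      apply k3
      rw [← h]; ring
  -- With X = r^n, the polynomial `f` is the defect between the path n → 2n+1 → 2n+2 → 2n+3 and the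
  -- path n → n+1 → 2n+3. Its constant terms cancel, so the linear coefficient A(r^3 - 1) is used to
  -- see that it is nonzero.
  · set f : ℂ[X] :=
      (1 + C (b * r ^ 5) * X ^ 4 - C (A * r ^ 4) * X ^ 2)
        * (1 + C (b * r ^ 7) * X ^ 4 - C (A * r ^ 5) * X ^ 2) * (1 + C (b * r ^ 3) * X ^ 2 - C A * X)
      - (1 + C (b * r ^ 3) * X ^ 2 - C (A * r ^ 3) * X)
        * ((1 + C (b * r ^ 5) * X ^ 4 - C (A * r) * X ^ 2)
        * (1 + C (b * r ^ 7) * X ^ 4 - C (A * r ^ 2) * X ^ 2)) with hf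
    have hfd : f.derivative.eval 0 ≠ 0 := by
      have : f.derivative.eval 0 = A * (r ^ 3 - 1) := by
        simp [hf]
        ring
      rw [this]
      exact mul_ne_zero hA (sub_ne_zero.2 h3)
    have hne := eventually_eval_zpow_ne_zero_of_derivative h0 hr hfd
    filter_upwards [hne, eventually_ge_atTop N, eventually_ge_atTop 0] with n hn hN hn0
    have s0 := second_difference_step h0 hF hN
    have s1 := second_difference_step h0 hF (n := 2 * n + 1) (by omega)
    have s2 := second_difference_step h0 hF (n := 2 * n + 2) (by omega)
    have d0 := second_difference_double h0 h1 hF hN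
    have d1 := second_difference_double h0 h1 hF (n := n + 1) (by omega)
    rw [show 2 * n + 1 + 3 = 2 * n + 4 by ring, show 2 * n + 1 + 2 = 2 * n + 3 by ring,
      show 2 * n + 1 + 1 = 2 * n + 2 by ring] at s1
    rw [show 2 * n + 2 + 3 = 2 * n + 5 by ring, show 2 * n + 2 + 2 = 2 * n + 4 by ring,
      show 2 * n + 2 + 1 = 2 * n + 3 by ring] at s2
    rw [show 2 * (n + 1) + 3 = 2 * n + 5 by ring, show 2 * (n + 1) + 2 = 2 * n + 4 by ring,
      show 2 * (n + 1) + 1 = 2 * n + 3 by ring, show n + 1 + 2 = n + 3 by ring,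
      show n + 1 + 1 = n + 2 by ring, zpow_add₀ h0 n, zpow_one] at d1
    have e1 : r ^ (2 * n + 1) = r ^ n * r ^ n * r := by
      rw [two_mul, zpow_add₀ h0, zpow_add₀ h0, zpow_one]
    have e2 : r ^ (2 * n + 2) = r ^ n * r ^ n * r ^ 2 := by
      rw [two_mul, zpow_add₀ h0, zpow_add₀ h0, zpow_ofNat]
    rw [e1] at s1
    rw [e2] at s2
    have hv : r ^ n ≠ 0 := zpow_ne_zero _ h0
    have hfe : f.eval (r ^ n) =
        (1 + b * r ^ 5 * (r ^ n) ^ 4 - A * r ^ 4 * (r ^ n) ^ 2)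
        * (1 + b * r ^ 7 * (r ^ n) ^ 4 - A * r ^ 5 * (r ^ n) ^ 2)
          * (1 + b * r ^ 3 * (r ^ n) ^ 2 - A * r ^ n)
      - (1 + b * r ^ 3 * (r ^ n) ^ 2 - A * r ^ 3 * r ^ n)
        * ((1 + b * r ^ 5 * (r ^ n) ^ 4 - A * r * (r ^ n) ^ 2)
        * (1 + b * r ^ 7 * (r ^ n) ^ 4 - A * r ^ 2 * (r ^ n) ^ 2)) := by
      simp [hf]
    rw [hfe] at hn
    generalize r ^ n = v at *
    generalize r * F (n + 3) - (1 + r) * F (n + 2) + F (n + 1) = g1 at *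
    generalize r * F (n + 2) - (1 + r) * F (n + 1) + F n = g0 at *
    generalize r * F (2 * n + 5) - (1 + r) * F (2 * n + 4) + F (2 * n + 3) = G3 at *
    generalize r * F (2 * n + 4) - (1 + r) * F (2 * n + 3) + F (2 * n + 2) = G2 at *
    generalize r * F (2 * n + 3) - (1 + r) * F (2 * n + 2) + F (2 * n + 1) = G1 at *
    subst d0 d1
    refine (mul_eq_zero.1 ?_).resolve_left
      (mul_ne_zero (mul_ne_zero (mul_ne_zero hb (pow_ne_zero 3 h0)) hv) hn)
    generalize hR1 : 1 + b * r ^ 5 * v ^ 4 - A * r ^ 4 * v ^ 2 = R1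
    generalize hR2 : 1 + b * r ^ 7 * v ^ 4 - A * r ^ 5 * v ^ 2 = R2
    generalize hS1 : 1 + b * r ^ 5 * v ^ 4 - A * r * v ^ 2 = S1
    generalize hS2 : 1 + b * r ^ 7 * v ^ 4 - A * r ^ 2 * v ^ 2 = S2
    have t1 : R1 * G2 = r * S1 * (-b * r * v * g0) := by
      rw [← hR1, ← hS1]; linear_combination s1
    have t2 : R2 * (-b * r * (v * r) * g1) = r * S2 * G2 := by
      rw [← hR2, ← hS2]; linear_combination s2
    have t3 : R1 * R2 * (b * r * (v * r) * g1) = r ^ 2 * S1 * S2 * (b * r * v * g0) := by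
      linear_combination -R1 * t2 - r * S2 * t1
    linear_combination (1 + b * r ^ 3 * v ^ 2 - A * r ^ 3 * v) * t3
      - R1 * R2 * b * r ^ 2 * v * s0

theorem exists_affine_of_ge (h0 : r ≠ 0) (h1 : r ≠ 1)
    (hF : ∀ n, N ≤ n → r * F (n + 2) - (1 + r) * F (n + 1) + F n = 0) :
    ∃ x y, ∀ n, N ≤ n → r ^ n * F n = x + y * r ^ n := by
  have hd : r - 1 ≠ 0 := sub_ne_zero.2 h1
  have hv : r ^ N ≠ 0 := zpow_ne_zero _ h0
  -- The constants solve r^n F(n) = x + y r^n for n = N and n = N + 1.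
  refine ⟨r ^ N * r * (F N - F (N + 1)) / (r - 1), (r * F (N + 1) - F N) / (r - 1), ?_⟩
  have key : ∀ j : ℕ, r ^ (N + j) * F (N + j) = r ^ N * r * (F N - F (N + 1)) / (r - 1)
      + (r * F (N + 1) - F N) / (r - 1) * r ^ (N + j) := by
    intro j
    induction j using Nat.strong_induction_on with
    | _ j ih =>
      match j with
      | 0 => simp; field_simp; ring
      | 1 => simp [zpow_add₀ h0]; field_simp; ring
      | j + 2 =>
        have i0 := ih j (by omega)
        have i1 := ih (j + 1) (by omega)
        have h := hF (N + j) (by omega)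
        push_cast at i1 ⊢
        rw [show N + ((j : ℤ) + 1) = N + j + 1 by ring] at i1
        rw [show N + ((j : ℤ) + 2) = N + j + 2 by ring]
        rw [zpow_add₀ h0 (N + j)] at i1 ⊢
        simp only [zpow_ofNat] at i1 ⊢
        linear_combination r * r ^ (N + (j : ℤ)) * h + (1 + r) * i1 - r * i0
  intro n hn
  have := key (n - N).toNat
  rwa [Int.toNat_of_nonneg (by omega), add_sub_cancel] at this

/-- The functions satisfying, for large arguments, the relation of the coefficients `f n` of
`L_n v = f n • v_n` for a vector `v` on top of which sits the tail of a module `V_{p,q}(a,b)`. -/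
theorem exists_affine (h0 : r ≠ 0) (hr : ∀ n : ℤ, n ≠ 0 → r ^ n ≠ 1) (hA : A ≠ 0)
    {f : ℤ → ℂ} (hf : ∀ n m, N ≤ n → N ≤ m → r ^ n * (1 - A * r ^ m + b * r ^ n * r ^ m) * f m
      - r ^ m * (1 - A * r ^ n + b * r ^ n * r ^ m) * f n = (r ^ n - r ^ m) * f (n + m)) :
    ∃ x y, y * (1 - A) = x * b ∧ ∀ᶠ n : ℤ in atTop, f n = x + y * r ^ n := by
  have h1 : r ≠ 1 := by simpa using hr 1 one_ne_zero
  have hF : ∀ n m, N ≤ n → N ≤ m →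
      f m / r ^ m * (1 - A * r ^ m + b * r ^ n * r ^ m)
      - f n / r ^ n * (1 - A * r ^ n + b * r ^ n * r ^ m)
        = (r ^ n - r ^ m) * (f (n + m) / r ^ (n + m)) := by
    intro n m hn hm
    have hun : r ^ n ≠ 0 := zpow_ne_zero _ h0
    have hum : r ^ m ≠ 0 := zpow_ne_zero _ h0
    have := hf n m hn hm
    rw [zpow_add₀ h0]
    field_simp
    linear_combination this
  obtain ⟨K, hK⟩ := eventually_atTop.1
    (second_difference_eventually_zero (F := fun n => f n / r ^ n) h0 hr hA hF)
  obtain ⟨x, y, hxy⟩ := exists_affine_of_ge (F := fun n => f n / r ^ n) h0 h1 hK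
  have hxy' : ∀ n, K ≤ n → f n = x + y * r ^ n := by
    intro n hn
    rw [← hxy n hn, mul_div_cancel₀ _ (zpow_ne_zero _ h0)]
  refine ⟨x, y, ?_, eventually_atTop.2 ⟨K, hxy'⟩⟩
  -- One instance of the relation, at (m, m+1), already forces the linear constraint on (x, y).
  set m := max (max K N) 0 with hm
  have hKm : K ≤ m := by omega
  have hNm : N ≤ m := by omega
  have h := hf m (m + 1) hNm (by omega)
  rw [hxy' m hKm, hxy' (m + 1) (by omega), hxy' (m + (m + 1)) (by omega)] at h
  simp only [zpow_add₀ h0 m, zpow_one] at h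
  have hv : r ^ m ≠ 0 := zpow_ne_zero _ h0
  have hd : r ^ m * r ^ m * r * r ^ m * (1 - r) ≠ 0 := by
    simp [hv, h0, sub_ne_zero, h1.symm]
  refine mul_left_cancel₀ hd ?_
  linear_combination -h

end Affine

/-! ### Coefficient systems and their loops -/

/-- The condition on `c` that the operators `X_n v_k = c n k • v_{n+k}` satisfy
`r ^ n X_n X_m - r ^ m X_m X_n = (r ^ n - r ^ m) X_{n+m}`. -/
def IsCoeff (r : ℂ) (c : ℤ → ℤ → ℂ) : Prop :=
  ∀ n m k, r ^ n * c n (m + k) * c m k - r ^ m * c m (n + k) * c n k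
    = (r ^ n - r ^ m) * c (n + m) k

/-- The coefficients of the modules `V_{p,q}(a,b)`, in the parameters `A = 1 + (p - q) a + b`
and `b`. -/
noncomputable def abCoeff (r A b : ℂ) (n k : ℤ) : ℂ := 1 - A * r ^ k + b * r ^ (n + k)

theorem isCoeff_abCoeff (h0 : r ≠ 0) (A b : ℂ) : IsCoeff r (abCoeff r A b) := by
  intro n m k
  simp only [abCoeff, zpow_add₀ h0]
  ring

theorem abCoeff_zero (A b : ℂ) (k : ℤ) : abCoeff r A b 0 k = 1 - (A - b) * r ^ k := by
  simp only [abCoeff, zero_add]; ring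

/-- The product of the coefficients along the loop `k → n + k → k`. -/
def loop (c : ℤ → ℤ → ℂ) (n k : ℤ) : ℂ := c (-n) (n + k) * c n k

theorem IsCoeff.loop_rec {c : ℤ → ℤ → ℂ} (hc : IsCoeff r c) (n k : ℤ) :
    r ^ (-n) * loop c n (n + k) - r ^ n * loop c n k = (r ^ (-n) - r ^ n) * c 0 (n + k) := by
  have h := hc (-n) n (n + k)
  rw [neg_add_cancel, neg_add_cancel_left] at h
  rw [← h, loop, loop]; ring

/-- The inhomogeneous term of `loop_rec` involves only `c 0`, so the difference of two solutions is
geometric. -/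
theorem IsCoeff.loop_sub_loop {c c' : ℤ → ℤ → ℂ} (h0 : r ≠ 0) (hc : IsCoeff r c)
    (hc' : IsCoeff r c') (h : ∀ k, c 0 k = c' 0 k) (n k : ℤ) :
    loop c n (n + k) - loop c' n (n + k) = r ^ (2 * n) * (loop c n k - loop c' n k) := by
  have h1 := hc.loop_rec n k
  have h2 := hc'.loop_rec n k
  rw [h, ← h2, zpow_neg] at h1
  have hv : r ^ n ≠ 0 := zpow_ne_zero _ h0
  rw [two_mul, zpow_add₀ h0]
  field_simp at h1
  linear_combination h1

theorem eq_zpow_mul_of_rec {D : ℤ → ℂ} {s : ℂ} (hs : s ≠ 0) (h : ∀ k, D (k + 1) = s * D k)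
    (k : ℤ) : D k = s ^ k * D 0 := by
  induction k with
  | zero => simp
  | succ i ih => rw [h, ih, zpow_add_one₀ hs]; ring
  | pred i ih =>
    have := h (-i - 1)
    rw [sub_add_cancel, ih] at this
    refine mul_left_cancel₀ hs ?_
    rw [← this, zpow_sub_one₀ hs]
    field_simp

theorem exists_eq_add_zpow_mul {D D' : ℤ → ℂ} {s : ℂ} (hs : s ≠ 0)
    (h : ∀ k, D (k + 1) - D' (k + 1) = s * (D k - D' k)) : ∃ t, ∀ k, D k = D' k + s ^ k * t :=
  ⟨D 0 - D' 0, fun k => by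
    rw [← eq_zpow_mul_of_rec (D := fun k => D k - D' k) hs h, add_sub_cancel]⟩

/-- This is the relation between X_2 and X_{-1} closed up by a further X_{-1}: it compares the
triangles k → k+2 → k+1 → k at consecutive k and leaves an L_1-loop as inhomogeneous term. -/
theorem loop_one_rec {c : ℤ → ℤ → ℂ} (hc : IsCoeff r c) (k : ℤ) :
    r ^ 2 * (c 2 k * c (-1) (k + 1) * c (-1) (k + 2))
      - r⁻¹ * (c 2 (k + 1) * c (-1) (k + 1 + 1) * c (-1) (k + 1 + 2))
      = (r ^ 2 - r⁻¹) * loop c 1 (k + 1) := by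
  have h := hc 2 (-1) (k + 1)
  rw [show -1 + (k + 1) = k by ring, show 2 + (k + 1) = k + 1 + 2 by ring,
    show (2 : ℤ) + -1 = 1 by ring, zpow_ofNat, zpow_neg_one] at h
  rw [loop, show 1 + (k + 1) = k + 2 by ring, show k + 1 + 1 = k + 2 by ring]
  linear_combination c (-1) (k + 2) * h

theorem loop_one_rec' {c : ℤ → ℤ → ℂ} (hc : IsCoeff r c) (k : ℤ) :
    r * (c (-2) (k + 2) * c 1 k * c 1 (k + 1))
      - (r ^ 2)⁻¹ * (c (-2) (k + 1 + 2) * c 1 (k + 1) * c 1 (k + 1 + 1))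
      = (r - (r ^ 2)⁻¹) * loop c 1 (k + 1) := by
  have h := hc 1 (-2) (k + 2)
  rw [show -2 + (k + 2) = k by ring, show 1 + (k + 2) = k + 1 + 2 by ring,
    show (1 : ℤ) + -2 = -1 by ring, zpow_neg, zpow_one, zpow_ofNat] at h
  rw [loop, show 1 + (k + 1) = k + 2 by ring, show k + 1 + 1 = k + 2 by ring]
  linear_combination c 1 (k + 1) * h

/-- The loops are those for (ν, 0) plus κ r^{2k}. Matching the coefficient of r^{2k} with A = ν + b
is a quadratic equation for b(1 - r), solvable over ℂ; the swap (A, b) ↔ (-b, -A) exchanges its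
roots. -/
theorem exists_loop_one_eq (h0 : r ≠ 0) (h1 : r ≠ 1) {c : ℤ → ℤ → ℂ} (hc : IsCoeff r c) {ν : ℂ}
    (hν : ∀ k, c 0 k = 1 - ν * r ^ k) :
    ∃ A b, A - b = ν ∧ ∀ k, loop c 1 k = loop (abCoeff r A b) 1 k := by
  obtain ⟨κ, hκ⟩ := exists_eq_add_zpow_mul (D := loop c 1) (D' := loop (abCoeff r ν 0) 1)
    (pow_ne_zero 2 h0) fun k => by
      have := hc.loop_sub_loop h0 (isCoeff_abCoeff h0 ν 0)
        (fun k => by rw [hν, abCoeff_zero, sub_zero]) 1 k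
      rw [add_comm k 1, this]; rfl
  have hd : 1 - r ≠ 0 := sub_ne_zero.2 h1.symm
  obtain ⟨s, hs⟩ := IsAlgClosed.exists_eq_mul_self ((ν * (1 - r)) ^ 2 - 4 * κ)
  obtain ⟨b, hb⟩ : ∃ b, b * (1 - r) = (-(ν * (1 - r)) + s) / 2 :=
    ⟨_, div_mul_cancel₀ _ hd⟩
  have hB : (b * (1 - r)) ^ 2 + ν * (1 - r) * (b * (1 - r)) + κ = 0 := by
    rw [hb]; linear_combination -hs / 4
  refine ⟨ν + b, b, by ring, fun k => ?_⟩
  rw [hκ, pow_two, mul_zpow]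
  simp only [loop, abCoeff, zpow_add₀ h0, zpow_neg, zpow_one]
  field_simp
  linear_combination r ^ k * r ^ k * hB

theorem eval_zero_of_eval_even_zpow (h0 : r ≠ 0) (hr : ∀ n : ℤ, n ≠ 0 → r ^ n ≠ 1) (f : ℂ[X])
    (h : ∀ j : ℤ, f.eval (r ^ (2 * j)) = 0) : f.eval 0 = 0 := by
  by_contra hf
  have h2 : ∀ n : ℤ, n ≠ 0 → (r ^ (2 : ℤ)) ^ n ≠ 1 := fun n hn => by
    rw [← zpow_mul]; exact hr _ (by omega)
  have := eventually_eval_zpow_ne_zero (zpow_ne_zero 2 h0) h2 (f := f)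
    (by rintro rfl; simp at hf)
  obtain ⟨n, hn⟩ := this.exists
  rw [← zpow_mul] at hn
  exact hn (h n)

/-- The parameters of the module are read off the products of coefficients along the loops that
start with `L_1` and `L_2`. -/
theorem exists_loops_eq (h0 : r ≠ 0) (hr : ∀ n : ℤ, n ≠ 0 → r ^ n ≠ 1) {c : ℤ → ℤ → ℂ}
    (hc : IsCoeff r c) {ν : ℂ} (hν : ∀ k, c 0 k = 1 - ν * r ^ k) :
    ∃ A b, A - b = ν ∧ ∀ k, loop c 1 k = loop (abCoeff r A b) 1 k ∧
      c 2 k * c (-1) (k + 1) * c (-1) (k + 2)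
        = abCoeff r A b 2 k * abCoeff r A b (-1) (k + 1) * abCoeff r A b (-1) (k + 2) ∧
      c (-2) (k + 2) * c 1 k * c 1 (k + 1)
        = abCoeff r A b (-2) (k + 2) * abCoeff r A b 1 k * abCoeff r A b 1 (k + 1) := by
  have h1 : r ≠ 1 := by simpa using hr 1 one_ne_zero
  obtain ⟨A, b, hAb, hP⟩ := exists_loop_one_eq h0 h1 hc hν
  have hM := isCoeff_abCoeff h0 A b
  have h0c : ∀ k, c 0 k = abCoeff r A b 0 k := fun k => by rw [hν, abCoeff_zero, hAb]
  obtain ⟨s, hs⟩ : ∃ s, ∀ k, c 2 k * c (-1) (k + 1) * c (-1) (k + 2)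
      = abCoeff r A b 2 k * abCoeff r A b (-1) (k + 1) * abCoeff r A b (-1) (k + 2)
        + (r ^ 3) ^ k * s := by
    refine exists_eq_add_zpow_mul (D := fun k => c 2 k * c (-1) (k + 1) * c (-1) (k + 2))
      (D' := fun k => abCoeff r A b 2 k * abCoeff r A b (-1) (k + 1) * abCoeff r A b (-1) (k + 2))
      (pow_ne_zero 3 h0) fun k => ?_
    have e1 := loop_one_rec hc k
    have e2 := loop_one_rec hM k
    rw [hP, ← e2] at e1
    field_simp at e1
    linear_combination -e1
  obtain ⟨t, ht⟩ : ∃ t, ∀ k, c (-2) (k + 2) * c 1 k * c 1 (k + 1)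
      = abCoeff r A b (-2) (k + 2) * abCoeff r A b 1 k * abCoeff r A b 1 (k + 1)
        + (r ^ 3) ^ k * t := by
    refine exists_eq_add_zpow_mul (D := fun k => c (-2) (k + 2) * c 1 k * c 1 (k + 1))
      (D' := fun k => abCoeff r A b (-2) (k + 2) * abCoeff r A b 1 k * abCoeff r A b 1 (k + 1))
      (pow_ne_zero 3 h0) fun k => ?_
    have e1 := loop_one_rec' hc k
    have e2 := loop_one_rec' hM k
    rw [hP, ← e2] at e1
    field_simp at e1
    linear_combination -e1
  -- The recursion for L_2-loops moves k by 2, so one constant governs only the even indices. They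
  -- suffice for comparing polynomials.
  obtain ⟨κ, hκ⟩ : ∃ κ, ∀ j : ℤ, loop c 2 (2 * j)
      = loop (abCoeff r A b) 2 (2 * j) + (r ^ 4) ^ j * κ := by
    refine exists_eq_add_zpow_mul (D := fun j => loop c 2 (2 * j))
      (D' := fun j => loop (abCoeff r A b) 2 (2 * j)) (pow_ne_zero 4 h0) fun j => ?_
    have := hc.loop_sub_loop h0 hM h0c 2 (2 * j)
    rw [show 2 * (j + 1) = 2 + 2 * j by ring, this]
    norm_cast
  set d : ℂ[X] := (1 - C (A - b * r ^ 2) * X) * (1 - C (A * r - b) * X)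
    * (1 - C (A * r ^ 2 - b * r) * X) with hd
  set e : ℂ[X] := (1 - C (A * r ^ 2 - b) * X) * (1 - C (A - b * r) * X)
    * (1 - C (A * r - b * r ^ 2) * X) with he
  have hde : ∀ k : ℤ,
      abCoeff r A b 2 k * abCoeff r A b (-1) (k + 1) * abCoeff r A b (-1) (k + 2)
        = d.eval (r ^ k) ∧
      abCoeff r A b (-2) (k + 2) * abCoeff r A b 1 k * abCoeff r A b 1 (k + 1)
        = e.eval (r ^ k) := by
    intro k
    simp only [hd, he, abCoeff, zpow_add₀ h0, zpow_neg, zpow_ofNat, eval_mul, eval_sub,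
      eval_one, eval_C, eval_X]
    constructor <;> field_simp <;> ring
  have hz3 : ∀ j : ℤ, (r ^ 3) ^ (2 * j) = (r ^ (2 * j)) ^ 3 := fun j => by
    rw [← zpow_natCast, ← zpow_natCast, ← zpow_mul, ← zpow_mul, mul_comm]
  have hz2 : ∀ j : ℤ, (r ^ 4) ^ j = (r ^ (2 * j)) ^ 2 := fun j => by
    rw [← zpow_natCast, ← zpow_natCast, ← zpow_mul, ← zpow_mul]; congr 1; push_cast; ring
  set P : ℂ[X] := (1 - C (A - b * r) * X) * (1 - C (A * r - b) * X)
    * ((1 - C (A * r - b * r ^ 2) * X) * (1 - C (A * r ^ 2 - b * r) * X)) with hPdef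
  have hPe : ∀ k : ℤ, loop (abCoeff r A b) 1 k * loop (abCoeff r A b) 1 (k + 1)
      = P.eval (r ^ k) := by
    intro k
    simp only [hPdef, loop, abCoeff, zpow_add₀ h0, zpow_neg, zpow_one, eval_mul, eval_sub,
      eval_one, eval_C, eval_X]
    field_simp
    ring
  -- The two opposite triangles use the same arrows as two L_1-loops and one L_2-loop. This ties the
  -- unknown constants s, t and κ together.
  have hprod : ∀ c : ℤ → ℤ → ℂ, ∀ k : ℤ, c 2 k * c (-1) (k + 1) * c (-1) (k + 2)
      * (c (-2) (k + 2) * c 1 k * c 1 (k + 1)) = loop c 1 k * loop c 1 (k + 1) * loop c 2 k := by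
    intro c k
    rw [loop, loop, loop, show 1 + (k + 1) = k + 2 by ring, add_comm 1 k, add_comm 2 k]
    ring
  have hmain : ∀ j : ℤ, (d.eval (r ^ (2 * j)) + (r ^ (2 * j)) ^ 3 * s)
      * (e.eval (r ^ (2 * j)) + (r ^ (2 * j)) ^ 3 * t)
      = d.eval (r ^ (2 * j)) * e.eval (r ^ (2 * j))
        + P.eval (r ^ (2 * j)) * (r ^ (2 * j)) ^ 2 * κ := by
    intro j
    have a1 := hprod c (2 * j)
    have a2 := hprod (abCoeff r A b) (2 * j)
    rw [hs, ht, hP, hP, hκ, hz3, hz2, mul_add (loop _ _ _ * _), ← a2, hPe, (hde _).1,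
      (hde _).2] at a1
    rw [a1]; ring
  have hz : ∀ j : ℤ, r ^ (2 * j) ≠ 0 := fun j => zpow_ne_zero _ h0
  -- With z = r^{2j}, divide by z² and compare at z = 0, where `P` is 1. Dividing by z³ and using
  -- d(0) = e(0) = 1 then gives s + t = 0.
  have hκ0 : κ = 0 := by
    have := eval_zero_of_eval_even_zpow h0 hr
      (X * (d * C t + e * C s + X ^ 3 * C (s * t)) - P * C κ) fun j => by
      refine (mul_eq_zero.1 ?_).resolve_left (pow_ne_zero 2 (hz j))
      simp only [eval_sub, eval_mul, eval_X, eval_add, eval_C, eval_pow]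
      linear_combination hmain j
    simpa [hPdef] using this
  have hst : s + t = 0 := by
    have := eval_zero_of_eval_even_zpow h0 hr
      (d * C t + e * C s + X ^ 3 * C (s * t)) fun j => by
      refine (mul_eq_zero.1 ?_).resolve_left (pow_ne_zero 3 (hz j))
      simp only [eval_mul, eval_X, eval_add, eval_C, eval_pow]
      have := hmain j
      rw [hκ0] at this
      linear_combination this
    simp [hd, he] at this
    linear_combination this
  by_cases ht0 : t = 0
  · have hs0 : s = 0 := by simpa [ht0] using hst
    refine ⟨A, b, hAb, fun k => ⟨hP k, ?_, ?_⟩⟩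
    · rw [hs, hs0]; ring
    · rw [ht, ht0]; ring
  -- Here d - e = T z³, so a nonzero t must equal T. The corrections then interchange `d` and `e`,
  -- which is the effect of the swap (A, b) ↔ (-b, -A).
  · set T := -(A - b * r ^ 2) * (A * r - b) ^ 2 * r + (A * r ^ 2 - b) * (A - b * r) ^ 2 * r
    have hT : ∀ z : ℂ, d.eval z - e.eval z = T * z ^ 3 := by
      intro z
      simp only [hd, he, eval_mul, eval_sub, eval_one, eval_C, eval_X, T]
      ring
    have htT : t = T := by
      have := hmain 0
      rw [hκ0] at this
      have hT1 := hT 1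
      simp only [mul_zero, zpow_zero] at this
      have hs' : s = -t := by linear_combination hst
      rw [hs'] at this
      refine mul_left_cancel₀ ht0 ?_
      linear_combination -this + t * hT1
    have hs' : s = -T := by rw [← htT]; linear_combination hst
    have hzk : ∀ k : ℤ, (r ^ 3) ^ k = (r ^ k) ^ 3 := fun k => by
      rw [← zpow_natCast, ← zpow_natCast, ← zpow_mul, ← zpow_mul, mul_comm]
    refine ⟨-b, -A, by rw [← hAb]; ring, fun k => ⟨?_, ?_, ?_⟩⟩
    · rw [hP]
      simp only [loop, abCoeff, zpow_add₀ h0, zpow_neg, zpow_one]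
      field_simp
      ring
    · have hk := hT (r ^ k)
      rw [hs, (hde k).1, hs', hzk]
      rw [show eval (r ^ k) d + (r ^ k) ^ 3 * -T = eval (r ^ k) e by linear_combination hk,
        ← (hde k).2]
      simp only [abCoeff, zpow_add₀ h0, zpow_neg, zpow_ofNat]
      field_simp
      ring
    · have hk := hT (r ^ k)
      rw [ht, (hde k).2, htT, hzk]
      rw [show eval (r ^ k) e + (r ^ k) ^ 3 * T = eval (r ^ k) d by linear_combination -hk,
        ← (hde k).1]
      simp only [abCoeff, zpow_add₀ h0, zpow_neg, zpow_ofNat]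
      field_simp
      ring

theorem exists_loops_eq_ne_zero (h0 : r ≠ 0) (hr : ∀ n : ℤ, n ≠ 0 → r ^ n ≠ 1) {c : ℤ → ℤ → ℂ}
    (hc : IsCoeff r c) {ν : ℂ} (hν0 : ν ≠ 0) (hν : ∀ k, c 0 k = 1 - ν * r ^ k) :
    ∃ A b, A ≠ 0 ∧ A - b = ν ∧ ∀ k, loop c 1 k = loop (abCoeff r A b) 1 k ∧
      c 2 k * c (-1) (k + 1) * c (-1) (k + 2)
        = abCoeff r A b 2 k * abCoeff r A b (-1) (k + 1) * abCoeff r A b (-1) (k + 2) ∧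
      c (-2) (k + 2) * c 1 k * c 1 (k + 1)
        = abCoeff r A b (-2) (k + 2) * abCoeff r A b 1 k * abCoeff r A b 1 (k + 1) := by
  obtain ⟨A, b, hAb, h⟩ := exists_loops_eq h0 hr hc hν
  by_cases hA : A = 0
  · subst hA
    have hb : b = -ν := by rw [← hAb]; ring
    -- For A = 0 the coefficient depends only on the target index, for the swapped pair only on the
    -- source. Along a closed path the products agree.
    refine ⟨-b, 0, by simpa [hb] using hν0, by rw [hb]; ring, fun k => ?_⟩
    obtain ⟨a1, a2, a3⟩ := h k
    rw [a1, a2, a3]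
    simp only [loop, abCoeff, zpow_add₀ h0, zpow_neg, zpow_ofNat]
    refine ⟨?_, ?_, ?_⟩ <;> field_simp <;> ring
  · exact ⟨A, b, hA, hAb, h⟩

/-! ### Rescaling the basis to match `abCoeff` -/

/-- The coefficients with respect to the rescaled basis `g k • v_k`. -/
noncomputable def regauge (g : ℤ → ℂ) (c : ℤ → ℤ → ℂ) (n k : ℤ) : ℂ := g k * c n k / g (n + k)

theorem regauge_regauge (g h : ℤ → ℂ) (c : ℤ → ℤ → ℂ) :
    regauge g (regauge h c) = regauge (fun k => g k * h k) c := by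
  ext n k
  simp only [regauge]
  rw [mul_div_assoc', div_div, mul_comm (g (n + k)), mul_assoc]

theorem regauge_zero {g : ℤ → ℂ} (hg : ∀ k, g k ≠ 0) (c : ℤ → ℤ → ℂ) (k : ℤ) :
    regauge g c 0 k = c 0 k := by
  rw [regauge, zero_add, mul_div_cancel_left₀ _ (hg k)]

theorem regauge_ne_zero {g : ℤ → ℂ} (hg : ∀ k, g k ≠ 0) {c : ℤ → ℤ → ℂ} {n k : ℤ} :
    regauge g c n k ≠ 0 ↔ c n k ≠ 0 := by
  simp [regauge, hg]

theorem IsCoeff.regauge {c : ℤ → ℤ → ℂ} (hc : IsCoeff r c) {g : ℤ → ℂ} (hg : ∀ k, g k ≠ 0) :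
    IsCoeff r (regauge g c) := by
  intro n m k
  have h := hc n m k
  simp only [Vpq.regauge]
  have h1 := hg k
  have h2 := hg (m + k)
  have h3 := hg (n + k)
  have h4 := hg (n + (m + k))
  rw [add_left_comm m n k, add_assoc n m k]
  field_simp
  linear_combination h

theorem loop_regauge {g : ℤ → ℂ} (hg : ∀ k, g k ≠ 0) (c : ℤ → ℤ → ℂ) (n k : ℤ) :
    loop (regauge g c) n k = loop c n k := by
  have h1 := hg k
  have h2 := hg (n + k)
  simp only [loop, regauge, neg_add_cancel_left]
  field_simp

theorem exists_partial_product {t : ℤ → ℂ} {K : ℤ} (ht : ∀ k, K ≤ k → t k ≠ 0) :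
    ∃ g : ℤ → ℂ, (∀ k, g k ≠ 0) ∧ ∀ k, K ≤ k → g (k + 1) = g k * t k := by
  -- Below K the product is empty, so g = 1 there.
  refine ⟨fun k => ∏ i ∈ Finset.range (k - K).toNat, t (K + i), fun k => ?_, fun k hk => ?_⟩
  · exact Finset.prod_ne_zero_iff.2 fun i _ => ht _ (by omega)
  · have h : (k + 1 - K).toNat = (k - K).toNat + 1 := by omega
    simp only [h, Finset.prod_range_succ]
    rw [Int.toNat_of_nonneg (by omega), add_sub_cancel]

theorem eventually_loop_one_ne_zero (h0 : r ≠ 0) (hr : ∀ n : ℤ, n ≠ 0 → r ^ n ≠ 1) (A b : ℂ) :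
    ∀ᶠ k : ℤ in atTop, loop (abCoeff r A b) 1 k ≠ 0 := by
  have h1 := eventually_add_mul_zpow_ne_zero h0 hr (x := 1) (y := -(A - b * r))
    (fun h => absurd h one_ne_zero)
  have h2 := eventually_add_mul_zpow_ne_zero h0 hr (x := 1) (y := -(A * r - b))
    (fun h => absurd h one_ne_zero)
  filter_upwards [h1, h2] with k h1 h2
  convert mul_ne_zero h1 h2 using 1
  simp only [loop, abCoeff, zpow_add₀ h0, zpow_neg, zpow_one]
  field_simp
  ring

/-- For n ≥ 2 the relation of X_n with X_1 determines X_{n+1}, because r^n ≠ r; the negative side is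
similar. At n = 1 the factor vanishes, which is why n = 2 is a hypothesis. All paths stay at indices
at least K. -/
theorem IsCoeff.eq_of_eq_on_generators {c c' : ℤ → ℤ → ℂ} (h0 : r ≠ 0)
    (hr : ∀ n : ℤ, n ≠ 0 → r ^ n ≠ 1) (hc : IsCoeff r c) (hc' : IsCoeff r c') {K : ℤ}
    (h : ∀ n : ℕ, n ≤ 2 → ∀ k, K ≤ k → c n k = c' n k ∧ c (-n) (n + k) = c' (-n) (n + k))
    {n k : ℤ} (hk : K ≤ k) (hnk : K ≤ n + k) : c n k = c' n k := by
  have hinj := zpow_injective_of_not_root h0 hr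
  have key : ∀ n : ℕ, ∀ k, K ≤ k → c n k = c' n k ∧ c (-n) (n + k) = c' (-n) (n + k) := by
    intro n
    induction n with
    | zero => exact h 0 (by norm_num)
    | succ n ih =>
      by_cases hn : n + 1 ≤ 2
      · exact h _ hn
      have h1 := h 1 (by norm_num)
      push_cast at h1 ⊢
      intro k hk
      constructor
      · have e := hc n 1 k
        have e' := hc' n 1 k
        rw [(ih (1 + k) (by omega)).1, (h1 k hk).1, (h1 (n + k) (by omega)).1, (ih k hk).1,
          e'] at e
        refine (mul_left_cancel₀ ?_ e).symm
        exact sub_ne_zero.2 fun hh => by have := hinj hh; omega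
      · have e := hc (-n) (-1) (n + 1 + k)
        have e' := hc' (-n) (-1) (n + 1 + k)
        have i1 := (ih k hk).2
        have i2 := (ih (1 + k) (by omega)).2
        have i3 := (h1 (n + k) (by omega)).2
        have i4 := (h1 k hk).2
        rw [← add_assoc] at i2 i3
        rw [add_comm 1 (n : ℤ)] at i3
        rw [show -1 + ((n : ℤ) + 1 + k) = n + k by ring,
          show -(n : ℤ) + (n + 1 + k) = 1 + k by ring,
          show -(n : ℤ) + -1 = -(n + 1) by ring] at e e'
        rw [i1, i2, i3, i4, e'] at e
        refine (mul_left_cancel₀ ?_ e).symm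
        exact sub_ne_zero.2 fun hh => by have := hinj hh; omega
  obtain ⟨m, rfl | rfl⟩ := n.eq_nat_or_neg
  · exact (key m k hk).1
  · have := (key m (-m + k) hnk).2
    rwa [add_neg_cancel_left] at this

/-- After rescaling the basis, the coefficients agree far up with those of some `V_{p,q}(a,b)`. -/
theorem exists_regauge_tail (h0 : r ≠ 0) (hr : ∀ n : ℤ, n ≠ 0 → r ^ n ≠ 1) {c : ℤ → ℤ → ℂ}
    (hc : IsCoeff r c) {ν : ℂ} (hν0 : ν ≠ 0) (hν : ∀ k, c 0 k = 1 - ν * r ^ k) :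
    ∃ A b, A ≠ 0 ∧ A - b = ν ∧ ∃ g : ℤ → ℂ, (∀ k, g k ≠ 0) ∧ ∃ K, ∀ n k, K ≤ k → K ≤ n + k →
      regauge g c n k = abCoeff r A b n k := by
  obtain ⟨A, b, hA, hAb, h⟩ := exists_loops_eq_ne_zero h0 hr hc hν0 hν
  obtain ⟨K, hK⟩ := eventually_atTop.1 (eventually_loop_one_ne_zero h0 hr A b)
  have hM1 : ∀ k, K ≤ k → abCoeff r A b 1 k ≠ 0 := fun k hk => right_ne_zero_of_mul (hK k hk)
  have hM2 : ∀ k, K ≤ k → abCoeff r A b (-1) (1 + k) ≠ 0 :=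
    fun k hk => left_ne_zero_of_mul (hK k hk)
  have hc1 : ∀ k, K ≤ k → c 1 k ≠ 0 := fun k hk => by
    have := hK k hk
    rw [← (h k).1] at this
    exact right_ne_zero_of_mul this
  obtain ⟨g, hg, hgK⟩ := exists_partial_product (t := fun k => c 1 k / abCoeff r A b 1 k) (K := K)
    fun k hk => div_ne_zero (hc1 k hk) (hM1 k hk)
  refine ⟨A, b, hA, hAb, g, hg, K, fun n k hk hnk => ?_⟩
  have k1 : ∀ k, K ≤ k → regauge g c 1 k = abCoeff r A b 1 k := by
    intro k hk
    have hgk := hg k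
    have hgk1 := hc1 k hk
    have hgk2 := hM1 k hk
    rw [regauge, add_comm, hgK k hk]
    field_simp
  have km1 : ∀ k, K ≤ k → regauge g c (-1) (1 + k) = abCoeff r A b (-1) (1 + k) := by
    intro k hk
    have := (h k).1
    rw [← loop_regauge hg, loop, loop, k1 k hk] at this
    exact mul_right_cancel₀ (hM1 k hk) this
  refine IsCoeff.eq_of_eq_on_generators h0 hr (hc.regauge hg) (isCoeff_abCoeff h0 A b)
    (fun n hn k hk => ?_) hk hnk
  interval_cases n
  · simp only [Nat.cast_zero, neg_zero, zero_add, and_self]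
    rw [regauge_zero hg, hν, abCoeff_zero, hAb]
  · exact ⟨k1 k hk, km1 k hk⟩
  · have e1 := (h k).2.1
    have e2 := (h k).2.2
    have a1 := km1 k hk
    have a2 := km1 (k + 1) (by omega)
    have b1 := hM2 k hk
    have b2 := hM2 (k + 1) (by omega)
    have a3 := k1 k hk
    have a4 := k1 (k + 1) (by omega)
    rw [show 1 + (k + 1) = k + 2 by ring] at a2 b2
    rw [add_comm 1 k] at a1 b1
    have t1 : c 2 k * c (-1) (k + 1) * c (-1) (k + 2)
        = regauge g c 2 k * regauge g c (-1) (k + 1) * regauge g c (-1) (k + 2) := by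
      have g1 := hg k
      have g2 := hg (k + 1)
      have g3 := hg (k + 2)
      simp only [regauge]
      rw [show -1 + (k + 1) = k by ring, show -1 + (k + 2) = k + 1 by ring, add_comm 2 k]
      field_simp
    have t2 : c (-2) (k + 2) * c 1 k * c 1 (k + 1)
        = regauge g c (-2) (k + 2) * regauge g c 1 k * regauge g c 1 (k + 1) := by
      have g1 := hg k
      have g2 := hg (k + 1)
      have g3 := hg (k + 2)
      simp only [regauge]
      rw [show -2 + (k + 2) = k by ring, show 1 + (k + 1) = k + 2 by ring, add_comm 1 k]
      field_simp
    rw [t1, a1, a2] at e1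
    rw [t2, a3, a4] at e2
    push_cast
    rw [add_comm 2 k]
    exact ⟨mul_right_cancel₀ b1 (mul_right_cancel₀ b2 e1),
      mul_right_cancel₀ (hM1 k hk) (mul_right_cancel₀ (hM1 (k + 1) (by omega)) e2)⟩

/-- The difference of the loops is multiplied by r^{2n} ≠ 0 when k moves up by n, and it vanishes
once k is in the tail. -/
theorem IsCoeff.loop_eq_of_tail {c c' : ℤ → ℤ → ℂ} (h0 : r ≠ 0) (hc : IsCoeff r c)
    (hc' : IsCoeff r c') (h : ∀ k, c 0 k = c' 0 k) {K : ℤ}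
    (hK : ∀ n k, K ≤ k → K ≤ n + k → c n k = c' n k) {n : ℤ} (hn : 1 ≤ n) (k : ℤ) :
    loop c n k = loop c' n k := by
  have key : ∀ j : ℕ, loop c n (j * n + k) - loop c' n (j * n + k)
      = (r ^ (2 * n)) ^ j * (loop c n k - loop c' n k) := by
    intro j
    induction j with
    | zero => simp
    | succ j ih =>
      have := hc.loop_sub_loop h0 hc' h n (j * n + k)
      rw [ih] at this
      push_cast
      rw [show ((j : ℤ) + 1) * n + k = n + (j * n + k) by ring, this]
      ring
  have hj := key (K - k).toNat
  have hle : K ≤ ((K - k).toNat : ℤ) * n + k := by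
    have := Int.self_le_toNat (K - k)
    nlinarith
  have hl : loop c n (((K - k).toNat : ℤ) * n + k) = loop c' n (((K - k).toNat : ℤ) * n + k) := by
    rw [loop, loop, hK n _ hle (by omega), hK (-n) _ (by omega) (by omega)]
  rw [hl, sub_self] at hj
  exact sub_eq_zero.1 ((mul_eq_zero.1 hj.symm).resolve_left
    (pow_ne_zero _ (zpow_ne_zero _ h0)))

theorem eventually_abCoeff_ne_zero (h0 : r ≠ 0) (hr : ∀ n : ℤ, n ≠ 0 → r ^ n ≠ 1) {A b : ℂ}
    {k : ℤ} (hk : A * r ^ k = 1 → b ≠ 0) : ∀ᶠ n : ℤ in atTop, abCoeff r A b n k ≠ 0 := by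
  have := eventually_add_mul_zpow_ne_zero h0 hr (x := 1 - A * r ^ k) (y := b * r ^ k)
    fun h => mul_ne_zero (hk (sub_eq_zero.1 h).symm) (zpow_ne_zero _ h0)
  filter_upwards [this] with n hn
  convert hn using 1
  rw [abCoeff, zpow_add₀ h0]; ring

/-- The coefficients of a vector below the tail. -/
theorem exists_scalar_of_tail (h0 : r ≠ 0) (hr : ∀ n : ℤ, n ≠ 0 → r ^ n ≠ 1) {c : ℤ → ℤ → ℂ}
    (hc : IsCoeff r c) {A b : ℂ} (hA : A ≠ 0) (h : ∀ k, c 0 k = abCoeff r A b 0 k) {K : ℤ}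
    (hK : ∀ n k, K ≤ k → K ≤ n + k → c n k = abCoeff r A b n k) {k : ℤ}
    (hk : A * r ^ k = 1 → b ≠ 0) :
    ∃ φ, φ ≠ 0 ∧ ∀ᶠ n : ℤ in atTop, φ * c n k = abCoeff r A b n k := by
  have hz : r ^ k ≠ 0 := zpow_ne_zero _ h0
  obtain ⟨x, y, hxy, hev⟩ := exists_affine (A := A * r ^ k) (b := b * r ^ k)
    (N := max (K - k) 0) h0 hr (mul_ne_zero hA hz) (f := fun n => c n k) fun n m hn hm => by
      have := hc n m k
      rw [hK n (m + k) (by omega) (by omega), hK m (n + k) (by omega) (by omega)] at this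
      rw [← this]
      simp only [abCoeff, zpow_add₀ h0]
      ring
  -- The constraint y(1 - A r^k) = x b r^k is a line through (1 - A r^k, b r^k), since `hk` excludes
  -- that both coordinates vanish.
  obtain ⟨ψ, hψ⟩ : ∃ ψ, ∀ᶠ n : ℤ in atTop, c n k = ψ * abCoeff r A b n k := by
    by_cases hA1 : A * r ^ k = 1
    · refine ⟨y / (b * r ^ k), ?_⟩
      have hb := hk hA1
      have hx : x = 0 := by
        rw [hA1, sub_self, mul_zero] at hxy
        exact (mul_eq_zero.1 hxy.symm).resolve_right (mul_ne_zero hb hz)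
      filter_upwards [hev] with n hn
      rw [hn, hx, abCoeff, hA1, zpow_add₀ h0]
      field_simp
      ring
    · have hne : 1 - A * r ^ k ≠ 0 := sub_ne_zero.2 (Ne.symm hA1)
      refine ⟨x / (1 - A * r ^ k), ?_⟩
      filter_upwards [hev] with n hn
      rw [hn, abCoeff, zpow_add₀ h0]
      field_simp
      linear_combination r ^ n * hxy
  have hne := eventually_abCoeff_ne_zero h0 hr hk
  -- If ψ = 0, the loops at k vanish for large n. They equal those of `abCoeff`, which do not.
  have hψ0 : ψ ≠ 0 := by
    rintro rfl
    have h2 := eventually_add_mul_zpow_ne_zero h0 hr (x := 1 + b * r ^ k) (y := -(A * r ^ k))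
      fun _ => neg_ne_zero.2 (mul_ne_zero hA hz)
    obtain ⟨n, hn1, hn2, hn3, hn4⟩ := (hne.and (h2.and (hψ.and (eventually_ge_atTop 1)))).exists
    have hl := hc.loop_eq_of_tail h0 (isCoeff_abCoeff h0 A b) h hK hn4 k
    rw [loop, hn3, zero_mul, mul_zero] at hl
    refine mul_ne_zero ?_ hn1 hl.symm
    convert hn2 using 1
    rw [abCoeff, neg_add_cancel_left, zpow_add₀ h0]; ring
  refine ⟨ψ⁻¹, inv_ne_zero hψ0, ?_⟩
  filter_upwards [hψ] with n hn
  rw [hn, inv_mul_cancel_left₀ hψ0]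

/-- After rescaling the basis, the coefficients agree with those of some `V_{p,q}(a,b)` except at
the vectors which `V_{p,q}(a,b)` annihilates. -/
theorem exists_regauge_eq_abCoeff (h0 : r ≠ 0) (hr : ∀ n : ℤ, n ≠ 0 → r ^ n ≠ 1)
    {c : ℤ → ℤ → ℂ} (hc : IsCoeff r c) {ν : ℂ} (hν0 : ν ≠ 0) (hν : ∀ k, c 0 k = 1 - ν * r ^ k) :
    ∃ A b, A - b = ν ∧ ∃ g : ℤ → ℂ, (∀ k, g k ≠ 0) ∧
      (∀ n k, 1 ≤ n → loop c n k = loop (abCoeff r A b) n k) ∧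
      ∀ n k, (A * r ^ k = 1 → b ≠ 0) → (A * r ^ (n + k) = 1 → b ≠ 0) →
        regauge g c n k = abCoeff r A b n k := by
  obtain ⟨A, b, hA, hAb, g, hg, K, hK⟩ := exists_regauge_tail h0 hr hc hν0 hν
  have hM := isCoeff_abCoeff h0 A b
  have hc1 := hc.regauge hg
  have h0c : ∀ k, regauge g c 0 k = abCoeff r A b 0 k := fun k => by
    rw [regauge_zero hg, hν, abCoeff_zero, hAb]
  -- The value 1 on the tail keeps the coefficients already matched there; at an annihilated vector
  -- below the tail, 1 is only a default.
  have hex : ∀ k, ∃ φ : ℂ, φ ≠ 0 ∧ (K ≤ k → φ = 1) ∧ ((A * r ^ k = 1 → b ≠ 0) →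
      ∀ᶠ n : ℤ in atTop, φ * regauge g c n k = abCoeff r A b n k) := by
    intro k
    by_cases hk : K ≤ k
    · refine ⟨1, one_ne_zero, fun _ => rfl, fun _ => ?_⟩
      filter_upwards [eventually_ge_atTop 0] with n hn
      rw [one_mul, hK n k hk (by omega)]
    · by_cases hs : A * r ^ k = 1 → b ≠ 0
      · obtain ⟨φ, hφ, hev⟩ := exists_scalar_of_tail h0 hr hc1 hA h0c hK hs
        exact ⟨φ, hφ, fun h => absurd h hk, fun _ => hev⟩
      · exact ⟨1, one_ne_zero, fun h => absurd h hk, fun h => absurd h hs⟩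
  choose φ hφ0 hφ1 hφ using hex
  have hev : ∀ k, (A * r ^ k = 1 → b ≠ 0) →
      ∀ᶠ n : ℤ in atTop, regauge φ (regauge g c) n k = abCoeff r A b n k := by
    intro k hk
    filter_upwards [hφ k hk, eventually_ge_atTop (K - k)] with n hn hn'
    rw [regauge, hφ1 (n + k) (by omega), div_one, hn]
  have hc2 := hc1.regauge hφ0
  refine ⟨A, b, hAb, fun k => φ k * g k, fun k => mul_ne_zero (hφ0 k) (hg k), fun n k hn => ?_,
    fun n k hk hnk => ?_⟩
  · rw [← hc1.loop_eq_of_tail h0 hM h0c hK hn, loop_regauge hg]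
  · rw [← regauge_regauge]
    have e3 := tendsto_atTop_add_const_left atTop n (tendsto_id (α := ℤ))
    -- For m large, every term of the relation of (n, m) at k is known except `c n k`, which is
    -- multiplied by the nonzero `c m (n + k)`.
    obtain ⟨m, m1, m2, m3, m4, m5⟩ := ((hev k hk).and ((hev (n + k) hnk).and
      ((e3.eventually (hev k hk)).and ((eventually_abCoeff_ne_zero h0 hr hnk).and
      (eventually_ge_atTop (|K| + |k| + |n|)))))).exists
    have hKm : K ≤ m + k := by
      have := le_abs_self K; have := neg_abs_le k; have := abs_nonneg n; omega
    have hKnm : K ≤ n + (m + k) := by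
      have := le_abs_self K; have := neg_abs_le k; have := neg_abs_le n; omega
    have e := hc2 n m k
    have e' := hM n m k
    have m6 : regauge φ (regauge g c) n (m + k) = abCoeff r A b n (m + k) := by
      rw [regauge, hφ1 _ hKm, hφ1 _ hKnm, one_mul, div_one, hK n _ hKm hKnm]
    simp only [id] at m3
    rw [m6, m1, m2, m3, ← e'] at e
    have hz : r ^ m * abCoeff r A b m (n + k) ≠ 0 := mul_ne_zero (zpow_ne_zero _ h0) m4
    refine mul_left_cancel₀ hz ?_
    linear_combination -e

/-! ### Connectedness and the exceptional vector -/

/-- Every set of indices that is closed under the non-zero coefficients, in both directions, is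
trivial. -/
def IsConn (c : ℤ → ℤ → ℂ) : Prop :=
  ∀ S : Set ℤ, (∀ n k, c n k ≠ 0 → (k ∈ S ↔ n + k ∈ S)) → S = ∅ ∨ S = Set.univ

/-- Otherwise the singleton {k} would be closed in both directions. -/
theorem IsConn.exists_ne_zero {c : ℤ → ℤ → ℂ} (hc : IsConn c) (k : ℤ) :
    ∃ n ≠ 0, c n k ≠ 0 ∨ c (-n) (n + k) ≠ 0 := by
  by_contra! h
  rcases hc {k} fun n j hnj => by
    simp only [Set.mem_singleton_iff]
    rcases eq_or_ne n 0 with rfl | hn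
    · rw [zero_add]
    constructor
    · rintro rfl
      exact absurd (h n hn).1 hnj
    · intro hj
      have := (h (-n) (neg_ne_zero.2 hn)).2
      rw [neg_neg, ← hj, neg_add_cancel_left] at this
      exact absurd this hnj with hS | hS
  · exact Set.singleton_ne_empty k hS
  · have : k + 1 ∈ ({k} : Set ℤ) := hS ▸ Set.mem_univ _
    simp at this

/-- The coefficients of the modules `V_{p,q}(α)` and `V_{p,q}(β)`, up to a shift of the index. -/
noncomputable def sourceCoeff (r x y : ℂ) (n k : ℤ) : ℂ :=
  if k = 0 then (1 - r ^ n) * (x + y * r ^ n) else 1 - r ^ (n + k)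

/-- The coefficients of the modules `V'_{p,q}(α')` and `V'_{p,q}(β')`. -/
noncomputable def targetCoeff (r x y : ℂ) (n k : ℤ) : ℂ :=
  if n + k = 0 then (1 - r ^ k) * (x + y * r ^ k) else 1 - r ^ k

theorem isCoeff_sourceCoeff (h0 : r ≠ 0) (x y : ℂ) : IsCoeff r (sourceCoeff r x y) := by
  intro n m k
  by_cases hk : k = 0
  · subst hk
    by_cases hm : m = 0
    · subst hm
      by_cases hn : n = 0
      · simp [hn]
      · simp [sourceCoeff, hn]
        ring
    by_cases hn : n = 0
    · subst hn; simp [sourceCoeff, hm]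
    simp only [sourceCoeff, hm, hn, add_zero, if_true, if_false, zpow_add₀ h0]
    ring
  · by_cases hm : m + k = 0
    · by_cases hn : n + k = 0
      · obtain rfl : n = m := by omega
        simp
      · simp only [sourceCoeff, hm, hk, hn, if_true, if_false]
        rw [show m + (n + k) = n by omega, show n + m + k = n by omega, zpow_zero]
        have : r ^ k * r ^ m = 1 := by rw [← zpow_add₀ h0, add_comm, hm, zpow_zero]
        rw [zpow_add₀ h0 n k]
        linear_combination r ^ n * (1 - r ^ n) * this
    · by_cases hn : n + k = 0
      · simp only [sourceCoeff, hm, hk, hn, if_true, if_false]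
        rw [show n + (m + k) = m by omega, show n + m + k = m by omega, zpow_zero]
        have : r ^ k * r ^ n = 1 := by rw [← zpow_add₀ h0, add_comm, hn, zpow_zero]
        rw [zpow_add₀ h0 m k]
        linear_combination -r ^ m * (1 - r ^ m) * this
      · simp only [sourceCoeff, hm, hk, hn, if_false, zpow_add₀ h0]
        ring

theorem isCoeff_targetCoeff (h0 : r ≠ 0) (x y : ℂ) : IsCoeff r (targetCoeff r x y) := by
  intro n m k
  by_cases hnm : n + m + k = 0
  · by_cases hm : m + k = 0
    · obtain rfl : n = 0 := by omega
      simp only [targetCoeff, hm, zero_add, zpow_zero, if_true]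
      split_ifs with h
      · have h' : m = 0 := by omega
        simp [h, h']
      · have : r ^ k * r ^ m = 1 := by rw [← zpow_add₀ h0, add_comm, hm, zpow_zero]
        linear_combination (1 - r ^ k) * (x + y * r ^ k) * this
    by_cases hn : n + k = 0
    · obtain rfl : m = 0 := by omega
      simp only [targetCoeff, hn, zero_add, add_zero, zpow_zero, if_true]
      split_ifs with h
      · have h' : n = 0 := by omega
        simp [h, h']
      · have : r ^ k * r ^ n = 1 := by rw [← zpow_add₀ h0, add_comm, hn, zpow_zero]
        linear_combination -(1 - r ^ k) * (x + y * r ^ k) * this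
    · have e1 : n + (m + k) = 0 := by omega
      have e2 : m + (n + k) = 0 := by omega
      simp only [targetCoeff, hnm, hm, hn, e1, e2, if_true, if_false]
      have h1 : r ^ n * r ^ m * r ^ k = 1 := by
        rw [← zpow_add₀ h0, ← zpow_add₀ h0, hnm, zpow_zero]
      simp only [zpow_add₀ h0]
      generalize r ^ n = u at *
      generalize r ^ m = w at *
      generalize r ^ k = z at *
      linear_combination (1 - z) * y * z * (u - w) * h1
  · have e1 : n + (m + k) ≠ 0 := by omega
    have e2 : m + (n + k) ≠ 0 := by omega
    by_cases hm : m + k = 0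
    · by_cases hn : n + k = 0
      · obtain rfl : n = m := by omega
        simp
      · have hn0 : n ≠ 0 := by omega
        simp only [targetCoeff, hnm, hm, hn, e2, add_zero, hn0, if_true, if_false, zpow_zero]
        have : r ^ k * r ^ m = 1 := by rw [← zpow_add₀ h0, add_comm, hm, zpow_zero]
        rw [zpow_add₀ h0 n k]
        linear_combination r ^ n * (1 - r ^ k) * this
    · by_cases hn : n + k = 0
      · have hm0 : m ≠ 0 := by omega
        simp only [targetCoeff, hnm, hm, hn, e1, add_zero, hm0, if_true, if_false, zpow_zero]
        have : r ^ k * r ^ n = 1 := by rw [← zpow_add₀ h0, add_comm, hn, zpow_zero]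
        rw [zpow_add₀ h0 m k]
        linear_combination -r ^ m * (1 - r ^ k) * this
      · simp only [targetCoeff, hnm, hm, hn, e1, e2, if_false, zpow_add₀ h0]
        ring

/-- The coefficients around the vector which the tail of the module `V_{p,q}(a,0)`
annihilates. -/
theorem exists_source_or_target (h0 : r ≠ 0) (hr : ∀ n : ℤ, n ≠ 0 → r ^ n ≠ 1)
    {c : ℤ → ℤ → ℂ} (hc : IsCoeff r c) (hconn : IsConn c)
    (h : ∀ n k, k ≠ 0 → n + k ≠ 0 → c n k = 1 - r ^ k) (h00 : c 0 0 = 0)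
    (hloop : ∀ n, 1 ≤ n → loop c n 0 = 0) :
    ∃ x y, (x = 0 → y ≠ 0) ∧ ∃ g : ℤ → ℂ, (∀ k, g k ≠ 0) ∧
      (regauge g c = sourceCoeff r x y ∨ regauge g c = targetCoeff r x y) := by
  have hne : ∀ n : ℤ, n ≠ 0 → 1 - r ^ n ≠ 0 := fun n hn => sub_ne_zero.2 (hr n hn).symm
  -- the coefficients out of the special vector
  obtain ⟨x, y, -, hev⟩ := exists_affine (A := 1) (b := 0) (N := 1) h0 hr one_ne_zero
    (f := fun n => c n 0) fun n m hn hm => by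
      have := hc n m 0
      rw [add_zero, add_zero, h n m (by omega) (by omega), h m n (by omega) (by omega)] at this
      rw [← this]; ring
  have hf : ∀ n, n ≠ 0 → c n 0 = x + y * r ^ n := by
    intro n hn
    have e3 := tendsto_atTop_add_const_left atTop n (tendsto_id (α := ℤ))
    obtain ⟨m, m1, m2, m3⟩ := (hev.and ((e3.eventually hev).and
      (eventually_ge_atTop (|n| + 1)))).exists
    have a1 := abs_nonneg n
    have a2 := neg_abs_le n
    have e := hc n m 0
    simp only [id] at m2
    rw [add_zero, add_zero, m1, m2, h n m (by omega) (by omega), h m n hn (by omega),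
      zpow_add₀ h0] at e
    have hz : r ^ m * (1 - r ^ n) ≠ 0 := mul_ne_zero (zpow_ne_zero _ h0) (hne n hn)
    refine mul_left_cancel₀ hz ?_
    linear_combination -e
  -- the coefficients into the special vector
  have hrel : ∀ n m, n ≠ 0 → m ≠ 0 → n + m ≠ 0 →
      r ^ m * (1 - r ^ (n + m)) * c (-n) n - r ^ n * (1 - r ^ (n + m)) * c (-m) m
        = (r ^ m - r ^ n) * c (-(n + m)) (n + m) := by
    intro n m hn hm hnm
    have e := hc (-n) (-m) (n + m)
    rw [h (-m) (n + m) hnm (by omega), h (-n) (n + m) hnm (by omega), ← neg_add,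
      show -m + (n + m) = n by ring, neg_add_cancel_left, zpow_neg, zpow_neg] at e
    have u1 : r ^ n ≠ 0 := zpow_ne_zero _ h0
    have u2 : r ^ m ≠ 0 := zpow_ne_zero _ h0
    field_simp at e
    linear_combination e
  obtain ⟨x', y', -, hev'⟩ := exists_affine (A := 1) (b := 0) (N := 1) h0 hr one_ne_zero
    (f := fun n => c (-n) n / (1 - r ^ n)) fun n m hn hm => by
      have := hrel n m (by omega) (by omega) (by omega)
      have v1 := hne n (by omega)
      have v2 := hne m (by omega)
      have v3 := hne (n + m) (by omega)
      rw [← div_mul_cancel₀ (c (-n) n) v1, ← div_mul_cancel₀ (c (-m) m) v2,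
        ← div_mul_cancel₀ (c (-(n + m)) (n + m)) v3] at this
      refine mul_left_cancel₀ v3 ?_
      linear_combination -this
  have hg : ∀ n, n ≠ 0 → c (-n) n = (1 - r ^ n) * (x' + y' * r ^ n) := by
    intro n hn
    have e3 := tendsto_atTop_add_const_left atTop n (tendsto_id (α := ℤ))
    obtain ⟨m, m1, m2, m3⟩ := (hev'.and ((e3.eventually hev').and
      (eventually_ge_atTop (|n| + 1)))).exists
    have a1 := abs_nonneg n
    have a2 := neg_abs_le n
    simp only [id] at m2
    have e := hrel n m hn (by omega) (by omega)
    have v1 := hne m (by omega)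
    have v2 := hne (n + m) (by omega)
    rw [div_eq_iff v1] at m1
    rw [div_eq_iff v2] at m2
    rw [m1, m2] at e
    have hz : r ^ m * (1 - r ^ (n + m)) ≠ 0 := mul_ne_zero (zpow_ne_zero _ h0) v2
    refine mul_left_cancel₀ hz ?_
    rw [zpow_add₀ h0] at *
    linear_combination e
  -- The loop at 0 is (1 - r^n)(x' + y' r^n)(x + y r^n). It vanishes for all n ≥ 1, while a nonzero
  -- factor x + y r^n is nonzero for large n.
  have hor : (x = 0 ∧ y = 0) ∨ (x' = 0 ∧ y' = 0) := by
    by_contra hcon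
    have p1 : x = 0 → y ≠ 0 := by tauto
    have p2 : x' = 0 → y' ≠ 0 := by tauto
    obtain ⟨n, n1, n2, n3⟩ := ((eventually_add_mul_zpow_ne_zero h0 hr p1).and
      ((eventually_add_mul_zpow_ne_zero h0 hr p2).and (eventually_ge_atTop 1))).exists
    have hl := hloop n n3
    rw [loop, add_zero, hf n (by omega), hg n (by omega)] at hl
    exact mul_ne_zero (mul_ne_zero (hne n (by omega)) n2) n1 hl
  obtain ⟨n, hn, hcn⟩ := hconn.exists_ne_zero 0
  rw [add_zero, hf n hn, hg n hn] at hcn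
  by_cases hx' : x' = 0 ∧ y' = 0
  -- This rescaling turns the generic coefficient 1 - r^k into 1 - r^(n+k), which vanishes on arrows
  -- into index 0.
  · refine ⟨x, y, ?_, fun k => if k = 0 then 1 else (1 - r ^ k)⁻¹, fun k => ?_, Or.inl ?_⟩
    · rintro rfl rfl
      simp [hx'.1, hx'.2] at hcn
    · dsimp only
      split_ifs with hk
      · exact one_ne_zero
      · exact inv_ne_zero (hne k hk)
    · ext n k
      simp only [regauge, sourceCoeff]
      by_cases hk : k = 0
      · subst hk
        by_cases hn : n = 0
        · subst hn; simp [h00]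
        · simp only [if_true, add_zero, hn, if_false, hf n hn]
          rw [div_inv_eq_mul]; ring
      · by_cases hnk : n + k = 0
        · obtain rfl : n = -k := by omega
          simp [hk, hg k hk, hx'.1, hx'.2]
        · have v1 := hne k hk
          have v2 := hne (n + k) hnk
          simp only [hk, hnk, if_false, h n k hk hnk]
          field_simp
  · have hx : x = 0 ∧ y = 0 := hor.resolve_right hx'
    refine ⟨x', y', fun h1 h2 => hx' ⟨h1, h2⟩, fun _ => 1, fun _ => one_ne_zero, Or.inr ?_⟩
    ext n k
    simp only [regauge, targetCoeff, one_mul, div_one]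
    by_cases hnk : n + k = 0
    · obtain rfl : n = -k := by omega
      rw [if_pos hnk]
      by_cases hk : k = 0
      · subst hk; simp [h00]
      · exact hg k hk
    · rw [if_neg hnk]
      by_cases hk : k = 0
      · subst hk
        rw [hf n (by omega), hx.1, hx.2]; simp
      · exact h n k hk hnk

/-- The coefficients of isomorphic modules. -/
def CoeffEquiv (c c' : ℤ → ℤ → ℂ) : Prop :=
  ∃ (s : ℤ) (g : ℤ → ℂ), (∀ k, g k ≠ 0) ∧ ∀ n k, g k * c n (k + s) = c' n k * g (n + k)

theorem classification_coeff (h0 : r ≠ 0) (hr : ∀ n : ℤ, n ≠ 0 → r ^ n ≠ 1)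
    {c : ℤ → ℤ → ℂ} (hc : IsCoeff r c) (hconn : IsConn c) {ν : ℂ} (hν0 : ν ≠ 0)
    (hν : ∀ k, c 0 k = 1 - ν * r ^ k) :
    (∃ A b, CoeffEquiv c (abCoeff r A b)) ∨ ∃ x y, (x = 0 → y ≠ 0) ∧
      (CoeffEquiv c (sourceCoeff r x y) ∨ CoeffEquiv c (targetCoeff r x y)) := by
  obtain ⟨A, b, hAb, g, hg, hloop, h⟩ := exists_regauge_eq_abCoeff h0 hr hc hν0 hν
  -- Such an s is the index of a vector annihilated by V_{p,q}(a,b). Shifting it to 0 turns A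
  -- r^(k+s) into r^k.
  by_cases hs : ∃ s : ℤ, A * r ^ s = 1 ∧ b = 0
  · right
    obtain ⟨s, hs, rfl⟩ := hs
    have hA : ∀ k : ℤ, A * r ^ (k + s) = r ^ k := fun k => by
      rw [zpow_add₀ h0]; linear_combination r ^ k * hs
    have hA1 : ∀ k : ℤ, k ≠ 0 → A * r ^ (k + s) ≠ 1 := fun k hk => by rw [hA]; exact hr k hk
    have hM : ∀ n k, abCoeff r A 0 n (k + s) = 1 - r ^ k := fun n k => by
      rw [abCoeff, hA]; ring
    obtain ⟨x, y, hxy, g', hg', hor⟩ := exists_source_or_target h0 hr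
      (c := fun n k => regauge g c n (k + s))
      (fun n m k => by
        have := hc.regauge hg n m (k + s)
        rwa [← add_assoc, ← add_assoc] at this)
      (fun S hS => by
        have hinj : Function.Surjective fun k : ℤ => k - s := fun k => ⟨k + s, by simp⟩
        have := hconn ((fun k => k - s) ⁻¹' S) fun n k hnk => by
          have := hS n (k - s) (by
            change regauge g c n (k - s + s) ≠ 0
            rw [sub_add_cancel]; exact (regauge_ne_zero hg).2 hnk)
          simpa [add_sub_assoc] using this
        rcases this with h | h
        · left; rwa [← Set.preimage_empty (f := fun k : ℤ => k - s),
            hinj.preimage_injective.eq_iff] at h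
        · right; rwa [← Set.preimage_univ (f := fun k : ℤ => k - s),
            hinj.preimage_injective.eq_iff] at h)
      (fun n k hk hnk => by
        rw [h n (k + s) (fun h => absurd h (hA1 k hk))
          (fun h => absurd h (by rw [← add_assoc]; exact hA1 _ hnk)), hM])
      (by
        rw [regauge_zero hg, hν, ← hAb, sub_zero, hA]; simp)
      (fun n hn => by
        have h1 := loop_regauge hg c n (0 + s)
        rw [hloop n (0 + s) hn] at h1
        simp only [loop] at h1 ⊢
        rw [add_assoc, h1, hM]; simp)
    have fin : ∀ c', regauge g' (fun n k => regauge g c n (k + s)) = c' → CoeffEquiv c c' := by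
      rintro _ rfl
      refine ⟨s, fun k => g' k * g (k + s), fun k => mul_ne_zero (hg' _) (hg _), fun n k => ?_⟩
      have k1 := hg' (n + k)
      have k2 := hg (n + k + s)
      simp only [regauge]
      rw [← add_assoc]
      field_simp
    exact ⟨x, y, hxy, hor.imp (fin _) (fin _)⟩
  · left
    push Not at hs
    refine ⟨A, b, 0, g, hg, fun n k => ?_⟩
    rw [← h n k (hs k) (hs _), regauge, add_zero, div_mul_cancel₀ _ (hg _)]

end CoeffClassification

/-! ### Shifts and projective scaling of the exceptional parameters -/

section CoeffEquiv

variable {r : ℂ}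

theorem IsCoeff.shift {c : ℤ → ℤ → ℂ} (hc : IsCoeff r c) (s : ℤ) :
    IsCoeff r fun n k => c n (k + s) := by
  intro n m k
  have := hc n m (k + s)
  rwa [← add_assoc, ← add_assoc] at this

theorem CoeffEquiv.shift {c c' : ℤ → ℤ → ℂ} (h : CoeffEquiv c c') (t : ℤ) :
    CoeffEquiv c fun n k => c' n (k + t) := by
  obtain ⟨s, g, hg, h⟩ := h
  refine ⟨t + s, fun k => g (k + t), fun k => hg _, fun n k => ?_⟩
  rw [← add_assoc, h, ← add_assoc]

/-- Only v_0 is rescaled. All arrows into it from other indices are zero, so just the arrows out of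
it change, and (x, y) matters only as a projective point. -/
theorem CoeffEquiv.scale_source {c : ℤ → ℤ → ℂ} {x y l : ℂ} (hl : l ≠ 0)
    (h : CoeffEquiv c (sourceCoeff r x y)) : CoeffEquiv c (sourceCoeff r (l * x) (l * y)) := by
  obtain ⟨s, g, hg, h⟩ := h
  refine ⟨s, fun k => if k = 0 then l * g k else g k, fun k => ?_, fun n k => ?_⟩
  · dsimp only
    split_ifs
    exacts [mul_ne_zero hl (hg k), hg k]
  · have := h n k
    simp only [sourceCoeff] at this ⊢
    by_cases hk : k = 0 <;> by_cases hn : n + k = 0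
    · obtain rfl : n = 0 := by omega
      simp_all
    · simp only [hk, if_true] at this ⊢
      rw [mul_assoc, this]
      simp only [hk ▸ hn, if_false]
      ring
    · simp only [hk, hn, if_true, if_false] at this ⊢
      rw [this]; simp
    · simp only [hk, hn, if_false] at this ⊢
      exact this

/-- Dual to the source case: the arrows out of v_0 to other indices vanish, so rescaling v_0 by l⁻¹
affects only those into it. -/
theorem CoeffEquiv.scale_target {c : ℤ → ℤ → ℂ} {x y l : ℂ} (hl : l ≠ 0)
    (h : CoeffEquiv c (targetCoeff r x y)) : CoeffEquiv c (targetCoeff r (l * x) (l * y)) := by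
  obtain ⟨s, g, hg, h⟩ := h
  refine ⟨s, fun k => if k = 0 then l⁻¹ * g k else g k, fun k => ?_, fun n k => ?_⟩
  · dsimp only
    split_ifs
    exacts [mul_ne_zero (inv_ne_zero hl) (hg k), hg k]
  · have := h n k
    simp only [targetCoeff] at this ⊢
    by_cases hk : k = 0 <;> by_cases hn : n + k = 0
    · obtain rfl : n = 0 := by omega
      simp_all
    · subst hk
      simp only [hn, if_true, if_false, zpow_zero, sub_self, zero_mul] at this ⊢
      rw [mul_assoc, this, mul_zero]
    · simp only [hk, hn, if_true, if_false] at this ⊢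
      rw [this]
      field_simp
    · simp only [hk, hn, if_false] at this ⊢
      exact this

end CoeffEquiv

/-! ### Passage between modules and coefficient systems -/

section Module

variable {p q : ℂ}

theorem zpow_neg_mul_zpow (n : ℤ) : p ^ (-n) * q ^ n = (q / p) ^ n := by
  rw [div_zpow, zpow_neg, div_eq_mul_inv, mul_comm]

theorem qint_div_zpow (hp : p ≠ 0) (n : ℤ) : qint p q n / p ^ n = (1 - (q / p) ^ n) / (p - q) := by
  have h1 : p ^ n ≠ 0 := zpow_ne_zero _ hp
  rw [qint, div_zpow, div_div, mul_comm, ← div_div, sub_div, div_self h1]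

theorem qint_sub (hp : p ≠ 0) (n m : ℤ) : qint p q m / p ^ m - qint p q n / p ^ n
    = ((q / p) ^ n - (q / p) ^ m) / (p - q) := by
  rw [qint_div_zpow hp, qint_div_zpow hp]; ring

theorem action_single (c : ℤ → ℤ → ℂ) (n k : ℤ) (a : ℂ) :
    action c n (Finsupp.single k a) = Finsupp.single (n + k) (a * c n k) := by
  simp [action, Finsupp.linearCombination_single]

theorem isModule_action (hp : p ≠ 0) (hpq : p ≠ q) {c : ℤ → ℤ → ℂ}
    (hc : IsCoeff (q / p) fun n k => (p - q) * c n k) : IsModule p q (action c) := by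
  intro n m v
  have hd : p - q ≠ 0 := sub_ne_zero.2 hpq
  rw [zpow_neg_mul_zpow, zpow_neg_mul_zpow, qint_sub hp]
  induction v using Finsupp.induction_linear with
  | zero => simp
  | add f g hf hg =>
    simp only [map_add, smul_add]
    rw [← hf, ← hg]; abel
  | single k a =>
    simp only [action_single, Finsupp.smul_single, smul_eq_mul]
    rw [show n + (m + k) = m + n + k by ring, show m + (n + k) = m + n + k by ring,
      ← Finsupp.single_sub]
    congr 1
    have h := hc n m k
    rw [add_comm n m] at h
    have : (p - q) * ((q / p) ^ n * (a * c m k * c n (m + k)) -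
        (q / p) ^ m * (a * c n k * c m (n + k)))
        = ((q / p) ^ n - (q / p) ^ m) * (a * c (m + n) k) := by
      refine mul_left_cancel₀ hd ?_
      linear_combination a * h
    rw [div_mul_eq_mul_div, eq_div_iff hd, ← this]; ring

variable {M : Type*} [AddCommGroup M] [Module ℂ M] {L : ℤ → Module.End ℂ M}
  {v : Module.Basis ℤ ℂ M} {c : ℤ → ℤ → ℂ}

theorem isCoeff_of_isModule (hp : p ≠ 0) (hpq : p ≠ q) (hL : IsModule p q L)
    (hv : ∀ n k, L n (v k) = c n k • v (n + k)) : IsCoeff (q / p) fun n k => (p - q) * c n k := by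
  intro n m k
  have hd : p - q ≠ 0 := sub_ne_zero.2 hpq
  have h := hL n m (v k)
  rw [zpow_neg_mul_zpow, zpow_neg_mul_zpow, qint_sub hp] at h
  simp only [hv, map_smul, smul_smul] at h
  rw [show n + (m + k) = n + m + k by ring, show m + (n + k) = n + m + k by ring,
    add_comm m n, ← sub_smul] at h
  have h' := smul_left_injective ℂ (v.ne_zero (n + m + k)) h
  rw [div_mul_eq_mul_div, eq_div_iff hd] at h'
  linear_combination (p - q) * h'

theorem injective_weight (h1 : HasOneDimWeightSpaces L)
    (hv : ∀ n k, L n (v k) = c n k • v (n + k)) : Function.Injective (c 0) := by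
  intro j k hjk
  by_contra hne
  have hmem : ∀ i, v i ∈ weightSpace L (c 0 i) := fun i => by
    rw [Module.End.mem_eigenspace_iff, hv, zero_add]
  have hj := hmem j
  have hk := hmem k
  rw [← hjk] at hk
  have hbot : weightSpace L (c 0 j) ≠ ⊥ := fun h => by
    rw [h, Submodule.mem_bot] at hj
    exact v.ne_zero j hj
  have hnz : (⟨v j, hj⟩ : weightSpace L (c 0 j)) ≠ 0 := fun h =>
    v.ne_zero j (congrArg Subtype.val h)
  obtain ⟨a, ha⟩ := (finrank_eq_one_iff_of_nonzero' _ hnz).1 (h1 _ hbot) ⟨v k, hk⟩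
  have ha' : a • v j = v k := congrArg Subtype.val ha
  have := congrArg (fun w => v.repr w k) ha'
  simp [hne] at this

/-- A set of indices closed in both directions and its complement span complementary submodules. -/
theorem isConn_of_isIndecomposable (hL : IsIndecomposable L)
    (hv : ∀ n k, L n (v k) = c n k • v (n + k)) : IsConn c := by
  intro S hS
  have hsub : ∀ T : Set ℤ, (∀ n k, c n k ≠ 0 → k ∈ T → n + k ∈ T) →
      IsSubmodule L (Submodule.span ℂ (v '' T)) := by
    intro T hT n w hw
    have : Submodule.span ℂ (v '' T) ≤ (Submodule.span ℂ (v '' T)).comap (L n) := by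
      rw [Submodule.span_le]
      rintro _ ⟨k, hk, rfl⟩
      simp only [Submodule.comap_coe, Set.mem_preimage, SetLike.mem_coe]
      rw [hv]
      by_cases h0 : c n k = 0
      · simp [h0]
      · exact Submodule.smul_mem _ _ (Submodule.subset_span ⟨_, hT n k h0 hk, rfl⟩)
    exact this hw
  have hcompl : IsCompl (Submodule.span ℂ (v '' S)) (Submodule.span ℂ (v '' Sᶜ)) := by
    constructor
    · exact v.linearIndependent.disjoint_span_image disjoint_compl_right
    · rw [codisjoint_iff, ← Submodule.span_union, ← Set.image_union, Set.union_compl_self,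
        Set.image_univ, v.span_eq]
  have hempty : ∀ T : Set ℤ, Submodule.span ℂ (v '' T) = ⊥ → T = ∅ := by
    intro T hT
    by_contra hne
    obtain ⟨k, hk⟩ := Set.nonempty_iff_ne_empty.2 hne
    have : v k ∈ Submodule.span ℂ (v '' T) := Submodule.subset_span ⟨k, hk, rfl⟩
    rw [hT, Submodule.mem_bot] at this
    exact v.ne_zero k this
  refine (hL.2 _ _ (hsub S fun n k h => (hS n k h).1)
    (hsub Sᶜ fun n k h hk hk' => hk ((hS n k h).2 hk')) hcompl).imp (hempty S) fun h => ?_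
  exact Set.compl_empty_iff.1 (hempty _ h)

theorem iso_action {c' : ℤ → ℤ → ℂ} (hpq : p ≠ q) (hv : ∀ n k, L n (v k) = c n k • v (n + k))
    (h : CoeffEquiv (fun n k => (p - q) * c n k) fun n k => (p - q) * c' n k) :
    Iso L (action c') := by
  obtain ⟨s, g, hg, h⟩ := h
  have hd : p - q ≠ 0 := sub_ne_zero.2 hpq
  set w : Module.Basis ℤ ℂ M :=
    (v.reindex (Equiv.subRight s)).unitsSMul fun k => Units.mk0 (g k) (hg k) with hw
  have hwk : ∀ k, w k = g k • v (k + s) := fun k => by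
    rw [hw, Module.Basis.unitsSMul_apply, Module.Basis.reindex_apply]; rfl
  refine ⟨w.repr, fun n x => ?_⟩
  have key : w.repr.toLinearMap ∘ₗ L n = action c' n ∘ₗ w.repr.toLinearMap := by
    refine w.ext fun k => ?_
    have hk : L n (w k) = c' n k • w (n + k) := by
      rw [hwk, hwk, map_smul, hv, smul_smul, smul_smul, ← add_assoc]
      congr 1
      refine mul_left_cancel₀ hd ?_
      linear_combination h n k
    simp [hk, action_single]
  exact LinearMap.congr_fun key x

end Module

/-! ### The five families as coefficient systems -/

section Parameters

variable {p q : ℂ}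

theorem actAB_coeff (hp : p ≠ 0) (hq : q ≠ 0) (hpq : p ≠ q) (a b : ℂ) :
    (fun n j : ℤ => (p - q) * (p ^ (-j) * qint p q j - a * p ^ (-j) * q ^ j
      - b * p ^ (-j - n) * q ^ j * qint p q n)) = abCoeff (q / p) (1 + a * (p - q) + b) b := by
  ext n j
  have hd : p - q ≠ 0 := sub_ne_zero.2 hpq
  simp only [abCoeff, qint, div_zpow, zpow_sub₀ hp, zpow_neg, zpow_add₀ hp, zpow_add₀ hq]
  field_simp
  ring

theorem actAlpha_coeff (hp : p ≠ 0) (hq : q ≠ 0) (hpq : p ≠ q) (α : ℂ) :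
    (fun n j : ℤ => (p - q) * (if j = -1 then
      -q ^ n * qint p q (-n) + qint p q (-n) * qint p q (n + 1) * p ^ (-n) * q ^ n * α
      else p ^ (-n - j - 1) * qint p q (n + j + 1)))
    = fun n j => sourceCoeff (q / p) (1 - p * α / (p - q)) (p * α / (p - q) * (q / p)) n (j + 1) := by
  ext n j
  have hd : p - q ≠ 0 := sub_ne_zero.2 hpq
  by_cases hj : j = -1
  · subst hj
    simp only [sourceCoeff, neg_add_cancel, if_true]
    simp only [qint, div_zpow, zpow_neg, zpow_add₀ hp, zpow_add₀ hq, zpow_one]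
    field_simp
    ring
  · have hj' : j + 1 ≠ 0 := by omega
    simp only [sourceCoeff, hj, hj', if_false]
    simp only [qint, div_zpow, zpow_sub₀ hp, zpow_neg, zpow_add₀ hp, zpow_add₀ hq, zpow_one]
    field_simp

theorem actBeta_coeff (hp : p ≠ 0) (hq : q ≠ 0) (hpq : p ≠ q) (β : ℂ) :
    (fun n j : ℤ => (p - q) * (if j = 1 then
      -q ^ n * qint p q (-n) + p ^ (-n) * q ^ n * qint p q n * qint p q (-n + 1) * β
      else -q ^ (n + j - 1) * qint p q (-n - j + 1)))
    = fun n j => sourceCoeff (q / p) (1 - p * β / (p - q) * (q / p)) (p * β / (p - q)) n (j + -1) := by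
  ext n j
  have hd : p - q ≠ 0 := sub_ne_zero.2 hpq
  by_cases hj : j = 1
  · subst hj
    simp only [sourceCoeff, add_neg_cancel, if_true]
    simp only [qint, div_zpow, zpow_neg, zpow_add₀ hp, zpow_add₀ hq, zpow_one]
    field_simp
    ring
  · have hj' : j + -1 ≠ 0 := by omega
    simp only [sourceCoeff, hj, hj', if_false]
    simp only [qint, div_zpow, zpow_sub₀ hp, zpow_sub₀ hq, zpow_neg, zpow_add₀ hp, zpow_add₀ hq,
      zpow_one]
    field_simp
    ring

theorem actAlpha'_coeff (hp : p ≠ 0) (hq : q ≠ 0) (hpq : p ≠ q) (α' : ℂ) :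
    (fun n j : ℤ => (p - q) * (if j = -n then
      p ^ n * qint p q (-n) + p ^ n * q ^ (-n) * qint p q (-n) * qint p q (n + 1) * α'
      else p ^ (-j) * qint p q j))
    = targetCoeff (q / p) (1 - p * α' / (p - q) * (q / p)) (p * α' / (p - q)) := by
  ext n j
  have hd : p - q ≠ 0 := sub_ne_zero.2 hpq
  by_cases hj : j = -n
  · subst hj
    simp only [targetCoeff, add_neg_cancel, if_true]
    simp only [qint, div_zpow, zpow_neg, zpow_add₀ hp, zpow_add₀ hq, zpow_one]
    field_simp
    ring
  · have hj' : n + j ≠ 0 := by omega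
    simp only [targetCoeff, hj, hj', if_false]
    simp only [qint, div_zpow, zpow_neg]
    field_simp

theorem actBeta'_coeff (hp : p ≠ 0) (hq : q ≠ 0) (hpq : p ≠ q) (β' : ℂ) :
    (fun n j : ℤ => (p - q) * (if j = -n then
      p ^ n * qint p q (-n) + p ^ n * q ^ (-n) * qint p q n * qint p q (-n + 1) * β'
      else p ^ (-j) * qint p q j))
    = targetCoeff (q / p) (1 - p * β' / (p - q)) (p * β' / (p - q) * (q / p)) := by
  ext n j
  have hd : p - q ≠ 0 := sub_ne_zero.2 hpq
  by_cases hj : j = -n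
  · subst hj
    simp only [targetCoeff, add_neg_cancel, if_true]
    simp only [qint, div_zpow, zpow_neg, zpow_add₀ hp, zpow_add₀ hq, zpow_one]
    field_simp
    ring
  · have hj' : n + j ≠ 0 := by omega
    simp only [targetCoeff, hj, hj', if_false]
    simp only [qint, div_zpow, zpow_neg]
    field_simp

end Parameters

/-- Every point of the projective line has coordinates of one of two shapes. -/
theorem exists_normalized {r x y : ℂ} (h0 : r ≠ 0) (h2 : r ^ 2 ≠ 1) (hxy : x = 0 → y ≠ 0) :
    ∃ l t, l ≠ 0 ∧ ((l * x = 1 - t ∧ l * y = t * r) ∨ (l * x = 1 - t * r ∧ l * y = t)) := by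
  -- The points (1 - t : t r) are those with r x + y ≠ 0, and (1 - t r : t) those with x + r y ≠ 0.
  -- Both forms vanish only at the origin because r² ≠ 1.
  by_cases h : r * x + y = 0
  · have h' : x + r * y ≠ 0 := by
      intro h'
      have hy : (1 - r ^ 2) * y = 0 := by linear_combination h - r * h'
      have hy0 := (mul_eq_zero.1 hy).resolve_left (sub_ne_zero.2 h2.symm)
      refine hxy ?_ hy0
      simpa [hy0] using h'
    refine ⟨(x + r * y)⁻¹, (x + r * y)⁻¹ * y, inv_ne_zero h', Or.inr ⟨?_, rfl⟩⟩
    field_simp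
    ring
  · refine ⟨r * (r * x + y)⁻¹, (r * x + y)⁻¹ * y, mul_ne_zero h0 (inv_ne_zero h), Or.inl ⟨?_, ?_⟩⟩
    · field_simp
      ring
    · ring

end Vpq

/-! ### The classification theorem -/

theorem theorem3p6 (p q : ℂ) (hp : p ≠ 0) (hq : q ≠ 0) (hpq : p ≠ q)
    (hroot : ∀ n : ℕ, 0 < n → q ^ n ≠ 1) :
    ((∀ a b : ℂ, Vpq.IsModule p q (Vpq.actAB p q a b)) ∧
      (∀ α : ℂ, Vpq.IsModule p q (Vpq.actAlpha p q α)) ∧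
      (∀ α' : ℂ, Vpq.IsModule p q (Vpq.actAlpha' p q α')) ∧
      (∀ β : ℂ, Vpq.IsModule p q (Vpq.actBeta p q β)) ∧
      (∀ β' : ℂ, Vpq.IsModule p q (Vpq.actBeta' p q β'))) ∧
    ∀ (M : Type*) [AddCommGroup M] [Module ℂ M] (L : ℤ → Module.End ℂ M),
      Vpq.IsModule p q L →
      Vpq.IsHarishChandra L →
      Vpq.HasOneDimWeightSpaces L →
      Vpq.IsZGraded L →
      Vpq.IsIndecomposable L →
      (∃ a b : ℂ, Vpq.Iso L (Vpq.actAB p q a b)) ∨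
      (∃ α : ℂ, Vpq.Iso L (Vpq.actAlpha p q α)) ∨
      (∃ α' : ℂ, Vpq.Iso L (Vpq.actAlpha' p q α')) ∨
      (∃ β : ℂ, Vpq.Iso L (Vpq.actBeta p q β)) ∨
      (∃ β' : ℂ, Vpq.Iso L (Vpq.actBeta' p q β')) := by
  have hr0 : q / p ≠ 0 := div_ne_zero hq hp
  have hd : p - q ≠ 0 := sub_ne_zero.2 hpq
  refine ⟨⟨fun a b => ?_, fun α => ?_, fun α' => ?_, fun β => ?_, fun β' => ?_⟩, ?_⟩
  · refine Vpq.isModule_action hp hpq ?_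
    rw [Vpq.actAB_coeff hp hq hpq]
    exact Vpq.isCoeff_abCoeff hr0 _ _
  · refine Vpq.isModule_action hp hpq ?_
    rw [Vpq.actAlpha_coeff hp hq hpq]
    exact (Vpq.isCoeff_sourceCoeff hr0 _ _).shift 1
  · refine Vpq.isModule_action hp hpq ?_
    rw [Vpq.actAlpha'_coeff hp hq hpq]
    exact Vpq.isCoeff_targetCoeff hr0 _ _
  · refine Vpq.isModule_action hp hpq ?_
    rw [Vpq.actBeta_coeff hp hq hpq]
    exact (Vpq.isCoeff_sourceCoeff hr0 _ _).shift (-1)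
  · refine Vpq.isModule_action hp hpq ?_
    rw [Vpq.actBeta'_coeff hp hq hpq]
    exact Vpq.isCoeff_targetCoeff hr0 _ _
  intro M _ _ L hL _ hone hgr hind
  obtain ⟨v, hv⟩ := hgr
  have hex : ∀ n k, ∃ a : ℂ, L n (v k) = a • v (n + k) := fun n k => by
    obtain ⟨a, ha⟩ := Submodule.mem_span_singleton.1 (hv n k)
    exact ⟨a, ha.symm⟩
  choose c hc using hex
  have hcoeff := Vpq.isCoeff_of_isModule hp hpq hL hc
  have hinj : Function.Injective fun k => (p - q) * c 0 k :=
    (mul_right_injective₀ hd).comp (Vpq.injective_weight hone hc)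
  have hconn : Vpq.IsConn fun n k => (p - q) * c n k := fun S hS =>
    Vpq.isConn_of_isIndecomposable hind hc S fun n k h => hS n k (mul_ne_zero hd h)
  obtain ⟨ν, hν⟩ : ∃ ν, ∀ k, (p - q) * c 0 k = 1 - ν * (q / p) ^ k := by
    refine ⟨1 - (p - q) * c 0 0, ?_⟩
    -- The set of indices where the weight formula holds contains 0 and, by the relation with m = 0,
    -- is closed under nonzero coefficients in both directions.
    have hS := hconn {k | (p - q) * c 0 k = 1 - (1 - (p - q) * c 0 0) * (q / p) ^ k}
      fun n k hnk => by
        have h := hcoeff n 0 k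
        simp only [zero_add, add_zero, zpow_zero, one_mul] at h
        have h' : (p - q) * c 0 (n + k) - 1 = (q / p) ^ n * ((p - q) * c 0 k - 1) := by
          refine mul_right_cancel₀ hnk ?_
          linear_combination -h
        have hu : (q / p) ^ n ≠ 0 := zpow_ne_zero _ hr0
        simp only [Set.mem_ofPred_eq]
        rw [zpow_add₀ hr0]
        constructor
        · intro hk
          linear_combination h' + (q / p) ^ n * hk
        · intro hk
          refine mul_left_cancel₀ hu ?_
          linear_combination hk - h'
    rcases hS with hS | hS
    · have : (0 : ℤ) ∈ (∅ : Set ℤ) := by rw [← hS]; simp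
      exact absurd this (Set.notMem_empty _)
    · intro k
      have : k ∈ Set.univ := Set.mem_univ k
      rwa [← hS] at this
  -- If ν = 0 all weights coincide, and if r^n = 1 those of v_n and v_0 do; both contradict
  -- injectivity of the weights.
  have hν0 : ν ≠ 0 := by
    rintro rfl
    refine zero_ne_one (hinj (?_ : (p - q) * c 0 0 = (p - q) * c 0 1))
    rw [hν, hν]; simp
  have hr : ∀ n : ℤ, n ≠ 0 → (q / p) ^ n ≠ 1 := by
    intro n hn h
    refine hn (hinj (?_ : (p - q) * c 0 n = (p - q) * c 0 0))
    rw [hν, hν, h]; simp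
  have hr2 : (q / p) ^ 2 ≠ 1 := by
    have := hr 2 two_ne_zero
    rwa [zpow_ofNat] at this
  have hpar : ∀ t, p * (t * (p - q) / p) / (p - q) = t := fun t => by field_simp
  rcases Vpq.classification_coeff hr0 hr hcoeff hconn hν0 hν with ⟨A, b, h⟩ | ⟨x, y, hxy, h⟩
  · left
    refine ⟨(A - 1 - b) / (p - q), b, Vpq.iso_action hpq hc ?_⟩
    rw [Vpq.actAB_coeff hp hq hpq, div_mul_cancel₀ _ hd]
    convert h using 2
    ring
  obtain ⟨l, t, hl, hlt⟩ := Vpq.exists_normalized hr0 hr2 hxy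
  right
  rcases h with h | h
  · have h' := h.scale_source hl
    rcases hlt with ⟨e1, e2⟩ | ⟨e1, e2⟩
    · left
      refine ⟨t * (p - q) / p, Vpq.iso_action hpq hc ?_⟩
      rw [Vpq.actAlpha_coeff hp hq hpq, hpar, ← e1, ← e2]
      exact h'.shift 1
    · right; right; left
      refine ⟨t * (p - q) / p, Vpq.iso_action hpq hc ?_⟩
      rw [Vpq.actBeta_coeff hp hq hpq, hpar, ← e1, ← e2]
      exact h'.shift (-1)
  -- For targets the two shapes change roles: (1 - t : t r) is the β'-family and (1 - t r : t) the
  -- α'-family.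
  · have h' := h.scale_target hl
    rcases hlt with ⟨e1, e2⟩ | ⟨e1, e2⟩
    · right; right; right
      refine ⟨t * (p - q) / p, Vpq.iso_action hpq hc ?_⟩
      rw [Vpq.actBeta'_coeff hp hq hpq, hpar, ← e1, ← e2]
      exact h'
    · right; left
      refine ⟨t * (p - q) / p, Vpq.iso_action hpq hc ?_⟩
      rw [Vpq.actAlpha'_coeff hp hq hpq, hpar, ← e1, ← e2]
      exact h'
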